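/- **Setting.** Let $n\ge 1$ be an integer and let $\lambda>0$, $p$, $m$ be real numbers with $1<p$, $(n-1)p<n$ (that is, $1<p<\frac{n}{n-1}$, with no upper bound if $n=1$) and $m>p$. Let $F(\xi,\tau,x)$ and $W(\tau,x)$ be real functions of $\xi,x\in\mathbb{R}^n$ and $\tau\in\mathbb R$ such that for all $\xi,x\in\mathbb{R}^n$ and $\tau\in[-1,1]$: * (A) $\lambda^{-1}|\xi|^p\le F(\xi,\tau,x)\le\lambda|\xi|^p$; * (B) $\lambda^{-1}(1-\tau^2)^m\le W(\tau,x)\le\lambda(1-\tau^2)^m$; * (C) for each fixed $x$, $W(\cdot,x)$ is (weakly) increasing on $[-1,0]$ and (weakly) decreasing on $[0,1]$. Put $J(v,D)=\int_D\{F(\nabla v,v,x)+W(v,x)\}\,dx$. For an open set $\Omega\subseteq\mathbb{R}^n$, a function $u\in W^{1,p}_{loc}(\Omega,[-1,1])$ is a *minimizer* of $J$ in $\Omega$ if $J(u,\Omega')\le J(v,\Omega')$ for every bounded open $\Omega'\subset\subset\Omega$ and every $v\in W^{1,p}_{loc}(\Omega,[-1,1])$ with $v=u$ a.e. in $\Omega\setminus\Omega'$.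 Since $u$ is only determined up to null sets, $u(0)$ denotes $\lim_{r\to0}\operatorname{ess\,sup}_{B_r}u$, where $B_r$ is the open ball of radius $r$ about $0$; this is the usual value if $u$ is continuous at $0$. **Lemma 2.3.** There exist a constant $\sigma>0$ and a function $h:[1,\infty)\to(0,\infty)$, both depending only on $n,p,m,\lambda$, such that the following holds for all $F,W$ satisfying (A), (B), (C), every $R\ge1$ and every open $\Omega\supseteq B_R$. If $u$ is a minimizer of $J$ in $\Omega$ and $u(0)\ge1-h(R)$, then $$\big|B_R\cap\{u\ge0\}\big|\ge\sigma R^n .$$ -/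

import Mathlib

open MeasureTheory Filter Topology Set

/-- The Dirichlet energy density `F(ξ, τ, x)` is comparable to `|ξ|^p`. -/
def DirichletGrowth {n : ℕ} (p lam : ℝ)
    (F : EuclideanSpace ℝ (Fin n) → ℝ → EuclideanSpace ℝ (Fin n) → ℝ) : Prop :=
  ∀ (ξ : EuclideanSpace ℝ (Fin n)) (τ : ℝ) (x : EuclideanSpace ℝ (Fin n)), τ ∈ Icc (-1 : ℝ) 1 →
    lam⁻¹ * ‖ξ‖ ^ p ≤ F ξ τ x ∧ F ξ τ x ≤ lam * ‖ξ‖ ^ p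

/-- The potential `W(τ, x)` is comparable to `(1 - τ²)^m`. -/
def PotentialGrowth {n : ℕ} (m lam : ℝ) (W : ℝ → EuclideanSpace ℝ (Fin n) → ℝ) : Prop :=
  ∀ (τ : ℝ) (x : EuclideanSpace ℝ (Fin n)), τ ∈ Icc (-1 : ℝ) 1 →
    lam⁻¹ * (1 - τ ^ 2) ^ m ≤ W τ x ∧ W τ x ≤ lam * (1 - τ ^ 2) ^ m

/-- For each `x`, `W(·, x)` is (weakly) increasing on `[-1, 0]` and (weakly)
decreasing on `[0, 1]`. -/
def PotentialMonotone {n : ℕ} (W : ℝ → EuclideanSpace ℝ (Fin n) → ℝ) : Prop :=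
  ∀ x : EuclideanSpace ℝ (Fin n),
    MonotoneOn (fun τ => W τ x) (Icc (-1 : ℝ) 0) ∧ AntitoneOn (fun τ => W τ x) (Icc (0 : ℝ) 1)

/-- `v ∈ W^{1,p}_loc(Ω)` with weak gradient `g`: both are in `L^p` on every compact subset of `Ω`,
and `∫_Ω v ∂ᵢφ = - ∫_Ω φ gᵢ` for all test functions `φ ∈ C_c^∞(Ω)`. The weak gradient is
determined by `v` almost everywhere in `Ω`. -/
structure HasWeakGradLoc {n : ℕ} (p : ℝ) (Ω : Set (EuclideanSpace ℝ (Fin n)))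
    (v : EuclideanSpace ℝ (Fin n) → ℝ)
    (g : EuclideanSpace ℝ (Fin n) → EuclideanSpace ℝ (Fin n)) : Prop where
  memLp : ∀ K : Set (EuclideanSpace ℝ (Fin n)), IsCompact K → K ⊆ Ω →
    MemLp v (ENNReal.ofReal p) (volume.restrict K)
  memLp_grad : ∀ K : Set (EuclideanSpace ℝ (Fin n)), IsCompact K → K ⊆ Ω →
    MemLp g (ENNReal.ofReal p) (volume.restrict K)
  integral_eq : ∀ φ : EuclideanSpace ℝ (Fin n) → ℝ, ContDiff ℝ (⊤ : ℕ∞) φ → HasCompactSupport φ →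
    tsupport φ ⊆ Ω → ∀ i : Fin n,
      ∫ x in Ω, v x * fderiv ℝ φ x (EuclideanSpace.single i 1) = - ∫ x in Ω, φ x * g x i

/-- The energy `J(v, D) = ∫_D {F(∇v, v, x) + W(v, x)} dx`, where `g = ∇v`. The integrand is
nonnegative almost everywhere for the functions `v` with values in `[-1, 1]`, to which it is
applied; the value `∞` is allowed. -/
noncomputable def glEnergy {n : ℕ}
    (F : EuclideanSpace ℝ (Fin n) → ℝ → EuclideanSpace ℝ (Fin n) → ℝ)
    (W : ℝ → EuclideanSpace ℝ (Fin n) → ℝ) (v : EuclideanSpace ℝ (Fin n) → ℝ)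
    (g : EuclideanSpace ℝ (Fin n) → EuclideanSpace ℝ (Fin n))
    (D : Set (EuclideanSpace ℝ (Fin n))) : ENNReal :=
  ∫⁻ x in D, ENNReal.ofReal (F (g x) (v x) x + W (v x) x)

/-- `u` is a minimizer of the energy in `Ω`: it belongs to `W^{1,p}_loc(Ω, [-1, 1])`, and
`J(u, Ω') ≤ J(v, Ω')` for every bounded open `Ω' ⊂⊂ Ω` and every `v ∈ W^{1,p}_loc(Ω, [-1, 1])` with
`v = u` almost everywhere in `Ω \ Ω'`. -/
def IsGLMinimizer {n : ℕ} (p : ℝ)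
    (F : EuclideanSpace ℝ (Fin n) → ℝ → EuclideanSpace ℝ (Fin n) → ℝ)
    (W : ℝ → EuclideanSpace ℝ (Fin n) → ℝ) (Ω : Set (EuclideanSpace ℝ (Fin n)))
    (u : EuclideanSpace ℝ (Fin n) → ℝ) : Prop :=
  (∀ᵐ x ∂(volume.restrict Ω), u x ∈ Icc (-1 : ℝ) 1) ∧
  ∃ gu : EuclideanSpace ℝ (Fin n) → EuclideanSpace ℝ (Fin n), HasWeakGradLoc p Ω u gu ∧
    ∀ Ω' : Set (EuclideanSpace ℝ (Fin n)), IsOpen Ω' → IsCompact (closure Ω') → closure Ω' ⊆ Ω →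
    ∀ (v : EuclideanSpace ℝ (Fin n) → ℝ)
      (gv : EuclideanSpace ℝ (Fin n) → EuclideanSpace ℝ (Fin n)),
      HasWeakGradLoc p Ω v gv →
      (∀ᵐ x ∂(volume.restrict Ω), v x ∈ Icc (-1 : ℝ) 1) →
      (∀ᵐ x ∂(volume.restrict (Ω \ Ω')), v x = u x) →
      glEnergy F W u gu Ω' ≤ glEnergy F W v gv Ω'

/-- The pointwise value of a class of functions modulo null sets: the essential upper limit
`lim_{r → 0} ess sup_{B_r(x)} u`. It does not change when `u` is modified on a null set, it is
`u x` if `u` is continuous at `x`, and it is at least the limit of the averages of `u` over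
`B_r(x)` wherever that limit exists and `u` is essentially bounded near `x`. -/
noncomputable def essValue {n : ℕ} (u : EuclideanSpace ℝ (Fin n) → ℝ)
    (x : EuclideanSpace ℝ (Fin n)) : ℝ :=
  limsup u (𝓝 x ⊓ ae volume)

theorem essValue_eq_of_continuousAt {n : ℕ} {u : EuclideanSpace ℝ (Fin n) → ℝ}
    {x : EuclideanSpace ℝ (Fin n)} (hu : ContinuousAt u x) : essValue u x = u x := by
  have hne : (𝓝 x ⊓ ae (volume : Measure (EuclideanSpace ℝ (Fin n)))).NeBot := by
    rw [Filter.inf_neBot_iff]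
    intro s hs t ht
    by_contra hst
    rw [Set.not_nonempty_iff_eq_empty] at hst
    have hsub : s ⊆ tᶜ := fun y hy hyt => by
      have : y ∈ s ∩ t := ⟨hy, hyt⟩
      rw [hst] at this
      exact this
    have h0 : volume s = 0 := measure_mono_null hsub (mem_ae_iff.1 ht)
    exact (Measure.measure_pos_of_mem_nhds volume hs).ne' h0
  exact (Tendsto.mono_left hu inf_le_left).limsup_eq

theorem essValue_congr_ae {n : ℕ} {u v : EuclideanSpace ℝ (Fin n) → ℝ}
    (huv : u =ᵐ[volume] v) (x : EuclideanSpace ℝ (Fin n)) : essValue u x = essValue v x :=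
  limsup_congr (huv.filter_mono inf_le_right)

/-! Argue by contraposition with `w = 1 - u ≥ 0`. If `{u ≥ 0}` occupies less than half of `B_{R/8}`,
then `w ≥ 1` on a fixed fraction of that ball, and a De Giorgi argument shows that `w` stays away
from zero near the origin. Since `h` may depend on `R`, the size of the lower bound is irrelevant;
only uniformity in `F`, `W`, `u` and `Ω` is needed.

The analytic input is one energy comparison. Replace `w` by `max w ψ`, where `ψ ≤ k ≤ 1`, `|∇ψ| ≤
kL` and `ψ ≤ 0` outside a ball. On `A = {w < ψ}` the new gradient costs at most a multiple of `k^p`,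
and the new potential at most a multiple of `(2k)^m`, which is again a multiple of `k^p` because `m
≥ p` and `k ≤ 1`. Hence `∫_A |∇u|^p ≤ C k^p |A|` (`lintegral_rpow_le`) with `C` independent of the
level `k`, as for minimizers of the Dirichlet energy alone.

Two consequences are combined. In `exists_measure_sublevel_le`, an isoperimetric inequality between
`{w < k/2}` and `{w ≥ k}` is applied at all dyadic levels: if both sets were large at many levels,
each of the disjoint layers `{k/2 ≤ w < k}` would have measure bounded below, and they could not all
fit in a ball. So `{w < k}` is small for some `k`. In `exists_forall_le_of_measure_lt_le`, an
iteration over increasing truncations turns smallness of `{w < k}` into `w ≥ k/2` almost everywhere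
on a smaller ball, whence `u(0) ≤ 1 - k/2`.

No Sobolev embedding is used. Both the Poincaré and the isoperimetric inequality come from the fact
that a translation by `h` moves a function in `L¹` by at most `|h|` times the `L¹` norm of its
gradient. The calculus of weak derivatives needed for truncations is derived from mollification. -/

set_option linter.unusedSectionVars false

/-! ### Mollification and approximation of weakly differentiable functions -/

section Mollification

open scoped Convolution ContDiff ENNReal
open ContinuousLinearMap (lsmul)

variable {E : Type*} [NormedAddCommGroup E] [NormedSpace ℝ E] [FiniteDimensional ℝ E]
  [MeasurableSpace E] [BorelSpace E] {μ : Measure E} [μ.IsAddHaarMeasure]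

/-- Continuity of translations in `L¹`. -/
theorem tendsto_lintegral_enorm_translate_sub {f : E → ℝ} (hf : Integrable f μ) :
    Tendsto (fun h => ∫⁻ x, ‖f (x - h) - f x‖ₑ ∂μ) (𝓝 0) (𝓝 0) := by
  have : Fact ((1 : ℝ≥0∞) ≠ ⊤) := ⟨ENNReal.one_ne_top⟩
  have hf1 : MemLp f 1 μ := memLp_one_iff_integrable.2 hf
  -- The translation is written as the action of the domain on `L¹`, which is jointly continuous;
  -- `mk (-h)` acts by precomposition with `x ↦ -h + x`.
  have hc : Continuous (fun h : E => DomAddAct.mk (-h) +ᵥ hf1.toLp f) := by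
    have h1 : Continuous (fun h : E => DomAddAct.mk (-h)) :=
      DomAddAct.continuous_mk.comp continuous_neg
    exact h1.vadd continuous_const
  have h2 := (hc.edist (continuous_const (y := hf1.toLp f))).tendsto 0
  have h3 : ∀ h : E, edist (DomAddAct.mk (-h) +ᵥ hf1.toLp f) (hf1.toLp f)
      = ∫⁻ x, ‖f (x - h) - f x‖ₑ ∂μ := by
    intro h
    rw [DomAddAct.mk_vadd_toLp, Lp.edist_toLp_toLp, eLpNorm_one_eq_lintegral_enorm]
    refine lintegral_congr fun x => ?_
    simp [sub_eq_neg_add]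
  simp_rw [h3] at h2
  simpa using h2

/-- If translations by vectors of length less than `φ.rOut` move `f` by at most `ε` in `L¹`, then
so does the convolution with `φ`. -/
theorem lintegral_enorm_normed_convolution_sub_le (φ : ContDiffBump (0 : E)) {f : E → ℝ}
    (hf : Integrable f μ) {ε : ℝ≥0∞}
    (hε : ∀ h ∈ Metric.ball (0 : E) φ.rOut, ∫⁻ x, ‖f (x - h) - f x‖ₑ ∂μ ≤ ε) :
    ∫⁻ x, ‖(φ.normed μ ⋆[lsmul ℝ ℝ, μ] f) x - f x‖ₑ ∂μ ≤ ε := by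
  have hconv : ∀ᵐ x ∂μ, ConvolutionExistsAt (φ.normed μ) f x (lsmul ℝ ℝ) μ :=
    φ.integrable_normed.ae_convolution_exists _ hf
  have hpt : ∀ᵐ x ∂μ, ‖(φ.normed μ ⋆[lsmul ℝ ℝ, μ] f) x - f x‖ₑ
      ≤ ∫⁻ t, ‖φ.normed μ t * (f (x - t) - f x)‖ₑ ∂μ := by
    filter_upwards [hconv] with x hx
    have h1 : (φ.normed μ ⋆[lsmul ℝ ℝ, μ] f) x - f x
        = ∫ t, φ.normed μ t * (f (x - t) - f x) ∂μ := by
      have : f x = ∫ t, φ.normed μ t * f x ∂μ := by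
        rw [integral_mul_const, φ.integral_normed, one_mul]
      conv_lhs => rw [this]
      rw [convolution_def, ← integral_sub hx.integrable (φ.integrable_normed.mul_const _)]
      congr 1 with t
      rw [mul_sub]
      rfl
    rw [h1]
    exact enorm_integral_le_lintegral_enorm _
  refine (lintegral_mono_ae hpt).trans ?_
  have hmeas : AEMeasurable (Function.uncurry fun x t : E =>
      ‖φ.normed μ t * (f (x - t) - f x)‖ₑ) (μ.prod μ) := by
    have h1 : AEStronglyMeasurable (fun q : E × E => lsmul ℝ ℝ (φ.normed μ q.2) (f (q.1 - q.2)))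
        (μ.prod μ) :=
      φ.integrable_normed.aestronglyMeasurable.convolution_integrand _ hf.aestronglyMeasurable
    have h2 : AEStronglyMeasurable (fun q : E × E => φ.normed μ q.2 * f q.1) (μ.prod μ) :=
      φ.integrable_normed.aestronglyMeasurable.comp_snd.mul hf.aestronglyMeasurable.comp_fst
    refine ((h1.sub h2).congr (Eventually.of_forall fun q => ?_)).enorm
    simp [mul_sub]
  rw [lintegral_lintegral_swap hmeas]
  calc ∫⁻ t, ∫⁻ x, ‖φ.normed μ t * (f (x - t) - f x)‖ₑ ∂μ ∂μ
      ≤ ∫⁻ t, ‖φ.normed μ t‖ₑ * ε ∂μ := by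
        refine lintegral_mono fun t => ?_
        simp_rw [enorm_mul]
        by_cases ht : t ∈ Metric.ball (0 : E) φ.rOut
        · rw [lintegral_const_mul' _ _ enorm_ne_top]
          gcongr
          exact hε t ht
        · rw [← φ.support_normed_eq (μ := μ), Function.notMem_support] at ht
          simp [ht]
    _ = ε := by
        rw [lintegral_mul_const _ φ.continuous_normed.measurable.enorm]
        have : ∫⁻ t, ‖φ.normed μ t‖ₑ ∂μ = 1 := by
          have h := ofReal_integral_eq_lintegral_ofReal (φ.integrable_normed (μ := μ))
            (Eventually.of_forall φ.nonneg_normed)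
          rw [φ.integral_normed, ENNReal.ofReal_one] at h
          rw [h]
          exact lintegral_congr fun t => Real.enorm_of_nonneg (φ.nonneg_normed t)
        rw [this, one_mul]

theorem tendsto_lintegral_enorm_normed_convolution_sub {φ : ℕ → ContDiffBump (0 : E)}
    (hφ : Tendsto (fun j => (φ j).rOut) atTop (𝓝 0)) {f : E → ℝ} (hf : Integrable f μ) :
    Tendsto (fun j => ∫⁻ x, ‖((φ j).normed μ ⋆[lsmul ℝ ℝ, μ] f) x - f x‖ₑ ∂μ) atTop (𝓝 0) := by
  rw [ENNReal.tendsto_nhds_zero]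
  intro ε hε
  have h1 := (ENNReal.tendsto_nhds_zero.1 (tendsto_lintegral_enorm_translate_sub hf)) ε hε
  obtain ⟨δ, hδ, hball⟩ := Metric.eventually_nhds_iff_ball.1 h1
  filter_upwards [hφ.eventually (gt_mem_nhds hδ)] with j hj
  exact lintegral_enorm_normed_convolution_sub_le (φ j) hf fun h hh =>
    hball h (Metric.ball_subset_ball hj.le hh)

/-- `v` has the weak derivative `d` in the direction `e` in `Ω`. -/
structure HasWeakDirDeriv (μ : Measure E) (Ω : Set E) (e : E) (v d : E → ℝ) : Prop where
  locallyIntegrableOn : LocallyIntegrableOn v Ω μ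
  locallyIntegrableOn_deriv : LocallyIntegrableOn d Ω μ
  integral_eq : ∀ φ : E → ℝ, ContDiff ℝ ∞ φ → HasCompactSupport φ → tsupport φ ⊆ Ω →
    ∫ x, v x * fderiv ℝ φ x e ∂μ = -∫ x, φ x * d x ∂μ

/-- A sequence of bump functions shrinking to the origin. -/
noncomputable def shrinkingBump (E : Type*) [NormedAddCommGroup E] (j : ℕ) :
    ContDiffBump (0 : E) where
  rIn := 1 / (2 * ((j : ℝ) + 1))
  rOut := 1 / ((j : ℝ) + 1)
  rIn_pos := by positivity
  rIn_lt_rOut := by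
    apply one_div_lt_one_div_of_lt <;> nlinarith [(Nat.cast_nonneg j : (0 : ℝ) ≤ j)]

theorem tendsto_shrinkingBump_rOut (E : Type*) [NormedAddCommGroup E] :
    Tendsto (fun j => (shrinkingBump E j).rOut) atTop (𝓝 0) :=
  tendsto_one_div_add_atTop_nhds_zero_nat

/-- Local approximation by smooth functions. -/
theorem HasWeakDirDeriv.exists_smooth_approx {Ω : Set E} {e : E} {v d : E → ℝ}
    (hv : HasWeakDirDeriv μ Ω e v d) (hΩ : IsOpen Ω) {K : Set E} (hK : IsCompact K)
    (hKΩ : K ⊆ Ω) :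
    ∃ s : ℕ → E → ℝ, (∀ j, ContDiff ℝ ∞ (s j)) ∧
      (∀ᵐ x ∂(μ.restrict K), Tendsto (fun j => s j x) atTop (𝓝 (v x))) ∧
      Tendsto (fun j => ∫⁻ x in K, ‖s j x - v x‖ₑ ∂μ) atTop (𝓝 0) ∧
      Tendsto (fun j => ∫⁻ x in K, ‖fderiv ℝ (s j) x e - d x‖ₑ ∂μ) atTop (𝓝 0) := by
  -- Only the values of `v` and `d` on a compact neighbourhood of `K` matter for bumps of radius
  -- less than `δ`. Truncating there makes both functions globally integrable.
  obtain ⟨δ, hδ, hδΩ⟩ := hK.exists_cthickening_subset_open hΩ hKΩ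
  set K' := Metric.cthickening δ K with hK'def
  have hK' : IsCompact K' := hK.cthickening
  have hKK' : K ⊆ K' := Metric.self_subset_cthickening K
  have hK'm : MeasurableSet K' := hK'.isClosed.measurableSet
  set f := K'.indicator v with hf
  set g := K'.indicator d with hg
  have hfi : Integrable f μ := (integrable_indicator_iff hK'm).2
    (hv.locallyIntegrableOn.integrableOn_compact_subset hδΩ hK')
  have hgi : Integrable g μ := (integrable_indicator_iff hK'm).2
    (hv.locallyIntegrableOn_deriv.integrableOn_compact_subset hδΩ hK')
  set φ := shrinkingBump E
  have hφ : Tendsto (fun j => (φ j).rOut) atTop (𝓝 0) := tendsto_shrinkingBump_rOut E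
  obtain ⟨N, hN⟩ : ∃ N, ∀ j ≥ N, (φ j).rOut < δ :=
    eventually_atTop.1 (hφ.eventually (gt_mem_nhds hδ))
  set s : ℕ → E → ℝ := fun j => (φ j).normed μ ⋆[lsmul ℝ ℝ, μ] f with hs
  -- On `K` mollification commutes with the weak derivative: `t ↦ ρ (x - t)` is an admissible test
  -- function once its support lies in `K'`. The sign from differentiating in `t` cancels the sign
  -- of the integration by parts.
  have hderiv : ∀ j ≥ N, ∀ x ∈ K, fderiv ℝ (s j) x e
      = ((φ j).normed μ ⋆[lsmul ℝ ℝ, μ] g) x := by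
    intro j hj x hx
    set ρ := (φ j).normed μ with hρ
    have hρs : ContDiff ℝ ∞ ρ := (φ j).contDiff_normed
    have hρc : HasCompactSupport ρ := (φ j).hasCompactSupport_normed
    set ψ : E → ℝ := fun t => ρ (x - t) with hψ
    have hψs : ContDiff ℝ ∞ ψ := hρs.comp (contDiff_const.sub contDiff_id)
    have hψK : Function.support ψ ⊆ Metric.closedBall x (φ j).rOut := by
      intro t ht
      have h1 : x - t ∈ Function.support ρ := ht
      rw [hρ, (φ j).support_normed_eq, mem_ball_zero_iff] at h1
      rw [Metric.mem_closedBall, dist_comm, dist_eq_norm]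
      exact h1.le
    have hψt : tsupport ψ ⊆ Metric.closedBall x (φ j).rOut :=
      closure_minimal hψK Metric.isClosed_closedBall
    have hballK : Metric.closedBall x (φ j).rOut ⊆ K' :=
      (Metric.closedBall_subset_closedBall (hN j hj).le).trans
        (Metric.closedBall_subset_cthickening hx δ)
    have hψc : HasCompactSupport ψ :=
      HasCompactSupport.of_support_subset_isCompact (isCompact_closedBall x _) hψK
    have hψd : ∀ t, fderiv ℝ ψ t e = -fderiv ℝ ρ (x - t) e := by
      intro t
      have h1 : HasFDerivAt ψ ((fderiv ℝ ρ (x - t)).comp (-ContinuousLinearMap.id ℝ E)) t :=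
        ((hρs.differentiable (by simp)) (x - t)).hasFDerivAt.comp t
          ((hasFDerivAt_id t).const_sub x)
      rw [h1.fderiv]
      simp
    have h1 := hv.integral_eq ψ hψs hψc (hψt.trans (hballK.trans hδΩ))
    have h2 : ∫ t, v t * fderiv ℝ ψ t e ∂μ = -∫ t, fderiv ℝ ρ (x - t) e * f t ∂μ := by
      rw [← integral_neg]
      refine integral_congr_ae (Eventually.of_forall fun t => ?_)
      by_cases ht : t ∈ K'
      · simp only [hψd, hf, indicator_of_mem ht]
        ring
      · have : fderiv ℝ ψ t = 0 := by
          by_contra hne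
          exact ht (hballK (hψt (support_fderiv_subset ℝ hne)))
        simp [this, hf, indicator_of_notMem ht]
    have h3 : ∫ t, ψ t * d t ∂μ = ∫ t, ρ (x - t) * g t ∂μ := by
      refine integral_congr_ae (Eventually.of_forall fun t => ?_)
      by_cases ht : t ∈ K'
      · simp only [hψ, hg, indicator_of_mem ht]
      · have : ψ t = 0 := by
          by_contra hne
          exact ht (hballK (hψK hne))
        simp [this, hg, indicator_of_notMem ht]
    rw [h2, h3, neg_inj] at h1
    have h4 := hρc.hasFDerivAt_convolution_left (lsmul ℝ ℝ) (hρs.of_le (by simp))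
      (hfi.locallyIntegrable) x
    have hex : ConvolutionExistsAt (fderiv ℝ ρ) f x ((lsmul ℝ ℝ).precompL E) μ :=
      (hρc.fderiv ℝ).convolutionExists_left _ (hρs.continuous_fderiv (by simp))
        hfi.locallyIntegrable x
    rw [hs, h4.fderiv, convolution_eq_swap, convolution_eq_swap,
      ContinuousLinearMap.integral_apply hex.integrable_swap]
    simpa using h1
  refine ⟨s, fun j => ?_, ?_, ?_, ?_⟩
  · exact (φ j).hasCompactSupport_normed.contDiff_convolution_left _
      (φ j).contDiff_normed hfi.locallyIntegrable
  -- Almost everywhere convergence requires bumps of bounded eccentricity; here `rOut = 2 * rIn`.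
  · have h1 : ∀ᵐ x ∂μ, Tendsto (fun j => s j x) atTop (𝓝 (f x)) :=
      ContDiffBump.ae_convolution_tendsto_right_of_locallyIntegrable (K := 2) hφ
        (Eventually.of_forall fun j => le_of_eq (by simp only [φ, shrinkingBump]; field_simp))
        hfi.locallyIntegrable
    filter_upwards [ae_restrict_of_ae h1, ae_restrict_mem hK.measurableSet] with x hx hxK
    rwa [hf, indicator_of_mem (hKK' hxK)] at hx
  · refine tendsto_of_tendsto_of_tendsto_of_le_of_le tendsto_const_nhds
      (tendsto_lintegral_enorm_normed_convolution_sub hφ hfi) (fun _ => zero_le) fun j => ?_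
    refine le_trans (le_of_eq ?_) (setLIntegral_le_lintegral K _)
    refine setLIntegral_congr_fun hK.measurableSet fun x hx => ?_
    simp only [hs, hf, indicator_of_mem (hKK' hx)]
  · refine tendsto_of_tendsto_of_tendsto_of_le_of_le' tendsto_const_nhds
      (tendsto_lintegral_enorm_normed_convolution_sub hφ hgi) (Eventually.of_forall fun _ => zero_le) ?_
    filter_upwards [eventually_ge_atTop N] with j hj
    refine le_trans (le_of_eq ?_) (setLIntegral_le_lintegral K _)
    refine setLIntegral_congr_fun hK.measurableSet fun x hx => ?_
    simp only [hderiv j hj x hx, hg, indicator_of_mem (hKK' hx)]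

end Mollification

/-! ### Calculus of weak directional derivatives -/

section WeakDerivCalculus

open scoped ContDiff ENNReal

variable {E : Type*} [NormedAddCommGroup E] [NormedSpace ℝ E]
  [MeasurableSpace E] [BorelSpace E] {μ : Measure E}

/-- The product of a locally integrable function with a test function is integrable. -/
theorem MeasureTheory.LocallyIntegrableOn.integrable_mul_of_tsupport_subset {Ω : Set E} {v φ : E → ℝ}
    (hv : LocallyIntegrableOn v Ω μ) (hφ : Continuous φ) (hφc : HasCompactSupport φ)
    (hφΩ : tsupport φ ⊆ Ω) : Integrable (fun x => v x * φ x) μ := by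
  have h1 : IntegrableOn v (tsupport φ) μ := hv.integrableOn_compact_subset hφΩ hφc
  have h2 : IntegrableOn (fun x => v x * φ x) (tsupport φ) μ :=
    h1.mul_continuousOn hφ.continuousOn hφc
  refine (integrableOn_iff_integrable_of_support_subset ?_).1 h2
  intro x hx
  refine subset_tsupport φ ?_
  simp only [Function.mem_support, ne_eq, mul_eq_zero, not_or] at hx
  exact hx.2

theorem ContDiff.continuous_fderiv_const {φ : E → ℝ} (hφ : ContDiff ℝ ∞ φ) (e : E) :
    Continuous fun x => fderiv ℝ φ x e :=
  (hφ.continuous_fderiv (by simp)).clm_apply continuous_const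

theorem MeasureTheory.LocallyIntegrableOn.integrable_mul_fderiv_of_tsupport_subset {Ω : Set E} {v φ : E → ℝ}
    (hv : LocallyIntegrableOn v Ω μ) (hφ : ContDiff ℝ ∞ φ) (hφc : HasCompactSupport φ)
    (hφΩ : tsupport φ ⊆ Ω) (e : E) : Integrable (fun x => v x * fderiv ℝ φ x e) μ :=
  hv.integrable_mul_of_tsupport_subset (hφ.continuous_fderiv_const e) (hφc.fderiv_apply ℝ e)
    ((tsupport_fderiv_apply_subset ℝ e).trans hφΩ)

namespace HasWeakDirDeriv

variable {Ω : Set E} {e : E} {v d v' d' : E → ℝ}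

theorem neg (h : HasWeakDirDeriv μ Ω e v d) :
    HasWeakDirDeriv μ Ω e (fun x => -v x) (fun x => -d x) := by
  refine ⟨h.1.neg, h.2.neg, fun φ hφ hφc hφΩ => ?_⟩
  have := h.3 φ hφ hφc hφΩ
  simp only [neg_mul, mul_neg, integral_neg, this]

theorem add (h : HasWeakDirDeriv μ Ω e v d) (h' : HasWeakDirDeriv μ Ω e v' d') :
    HasWeakDirDeriv μ Ω e (fun x => v x + v' x) (fun x => d x + d' x) := by
  refine ⟨h.1.add h'.1, h.2.add h'.2, fun φ hφ hφc hφΩ => ?_⟩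
  have h1 := h.2.integrable_mul_of_tsupport_subset hφ.continuous hφc hφΩ
  have h2 := h'.2.integrable_mul_of_tsupport_subset hφ.continuous hφc hφΩ
  simp only [mul_comm _ (φ _)] at h1 h2
  simp only [add_mul, mul_add]
  rw [integral_add (h.1.integrable_mul_fderiv_of_tsupport_subset hφ hφc hφΩ e)
    (h'.1.integrable_mul_fderiv_of_tsupport_subset hφ hφc hφΩ e), integral_add h1 h2,
    h.3 φ hφ hφc hφΩ, h'.3 φ hφ hφc hφΩ, neg_add]

theorem sub (h : HasWeakDirDeriv μ Ω e v d) (h' : HasWeakDirDeriv μ Ω e v' d') :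
    HasWeakDirDeriv μ Ω e (fun x => v x - v' x) (fun x => d x - d' x) := by
  simpa only [sub_eq_add_neg] using h.add h'.neg

theorem congr_right (h : HasWeakDirDeriv μ Ω e v d) (hd : ∀ x, d x = d' x) :
    HasWeakDirDeriv μ Ω e v d' := by
  rwa [← funext hd]

variable [FiniteDimensional ℝ E] [μ.IsAddHaarMeasure]

theorem of_contDiff (Ω : Set E) (e : E) {ψ : E → ℝ} (hψ : ContDiff ℝ 1 ψ) :
    HasWeakDirDeriv μ Ω e ψ (fun x => fderiv ℝ ψ x e) := by
  have hd : Continuous fun x => fderiv ℝ ψ x e :=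
    (hψ.continuous_fderiv (by simp)).clm_apply continuous_const
  refine ⟨hψ.continuous.locallyIntegrable.locallyIntegrableOn _,
    hd.locallyIntegrable.locallyIntegrableOn _, fun φ hφ hφc hφΩ => ?_⟩
  have h1 : LocallyIntegrableOn ψ univ μ := hψ.continuous.locallyIntegrable.locallyIntegrableOn _
  have h2 : LocallyIntegrableOn (fun x => fderiv ℝ ψ x e) univ μ :=
    hd.locallyIntegrable.locallyIntegrableOn _
  rw [integral_mul_fderiv_eq_neg_fderiv_mul_of_integrable
    (h2.integrable_mul_of_tsupport_subset hφ.continuous hφc (subset_univ _))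
    (h1.integrable_mul_fderiv_of_tsupport_subset hφ hφc (subset_univ _) e)
    (h1.integrable_mul_of_tsupport_subset hφ.continuous hφc (subset_univ _))
    (fun x _ => hψ.differentiable (by simp) x) (fun x _ => hφ.differentiable (by simp) x)]
  simp only [mul_comm]

/-- Weak directional derivatives pass to limits in `L¹` on compact sets. -/
theorem of_tendsto
    (hv : LocallyIntegrableOn v Ω μ) (hd : LocallyIntegrableOn d Ω μ)
    (hs : ∀ K, IsCompact K → K ⊆ Ω → ∃ s t : ℕ → E → ℝ,
      (∀ j, HasWeakDirDeriv μ Ω e (s j) (t j)) ∧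
      Tendsto (fun j => ∫⁻ x in K, ‖s j x - v x‖ₑ ∂μ) atTop (𝓝 0) ∧
      Tendsto (fun j => ∫⁻ x in K, ‖t j x - d x‖ₑ ∂μ) atTop (𝓝 0)) :
    HasWeakDirDeriv μ Ω e v d := by
  refine ⟨hv, hd, fun φ hφ hφc hφΩ => ?_⟩
  obtain ⟨s, t, hst, hs, ht⟩ := hs (tsupport φ) hφc hφΩ
  -- `L¹` convergence on the support of `φ` passes to integrals against any bounded factor supported
  -- there; it is applied both to `∂φ` and to `φ`.
  have key : ∀ (a : ℕ → E → ℝ) (b χ : E → ℝ), Continuous χ → HasCompactSupport χ →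
      tsupport χ ⊆ tsupport φ → (∀ j, LocallyIntegrableOn (a j) Ω μ) →
      LocallyIntegrableOn b Ω μ →
      Tendsto (fun j => ∫⁻ x in tsupport φ, ‖a j x - b x‖ₑ ∂μ) atTop (𝓝 0) →
      Tendsto (fun j => ∫ x, a j x * χ x ∂μ) atTop (𝓝 (∫ x, b x * χ x ∂μ)) := by
    intro a b χ hχ hχc hχφ ha hb hab
    obtain ⟨C, hC⟩ := hχ.bounded_above_of_compact_support hχc
    refine tendsto_integral_of_L1 _
      (hb.integrable_mul_of_tsupport_subset hχ hχc (hχφ.trans hφΩ)).aestronglyMeasurable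
      (Eventually.of_forall fun j =>
        (ha j).integrable_mul_of_tsupport_subset hχ hχc (hχφ.trans hφΩ)) ?_
    have hlim : Tendsto (fun j => ENNReal.ofReal C * ∫⁻ x in tsupport φ, ‖a j x - b x‖ₑ ∂μ)
        atTop (𝓝 0) := by
      simpa using ENNReal.Tendsto.const_mul hab (Or.inr ENNReal.ofReal_ne_top)
    refine tendsto_of_tendsto_of_tendsto_of_le_of_le tendsto_const_nhds hlim
      (fun _ => zero_le) fun j => ?_
    rw [← lintegral_const_mul' _ _ ENNReal.ofReal_ne_top,
      ← lintegral_indicator (isClosed_tsupport φ).measurableSet]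
    refine lintegral_mono fun x => ?_
    by_cases hx : x ∈ tsupport φ
    · rw [indicator_of_mem hx, ← sub_mul, enorm_mul, mul_comm]
      gcongr
      rw [← ofReal_norm]
      exact ENNReal.ofReal_le_ofReal (hC x)
    · have : χ x = 0 := image_eq_zero_of_notMem_tsupport fun h => hx (hχφ h)
      simp [this]
  have h1 := key s v (fun x => fderiv ℝ φ x e) (hφ.continuous_fderiv_const e)
    (hφc.fderiv_apply ℝ e) (tsupport_fderiv_apply_subset ℝ e) (fun j => (hst j).1) hv hs
  have h2 := key t d φ hφ.continuous hφc subset_rfl (fun j => (hst j).2) hd ht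
  simp only [mul_comm _ (φ _)] at h2
  refine tendsto_nhds_unique h1 (h2.neg.congr fun j => ?_)
  exact ((hst j).3 φ hφ hφc hφΩ).symm

/-- The chain rule for outer functions with a continuous bounded derivative. -/
theorem comp (h : HasWeakDirDeriv μ Ω e v d) (hΩ : IsOpen Ω) {F F' : ℝ → ℝ}
    (hF : ∀ t, HasDerivAt F (F' t) t) (hF' : Continuous F') {C : ℝ} (hC : ∀ t, |F' t| ≤ C) :
    HasWeakDirDeriv μ Ω e (fun x => F (v x)) (fun x => F' (v x) * d x) := by
  have hC0 : 0 ≤ C := (abs_nonneg _).trans (hC 0)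
  have hFd : Differentiable ℝ F := fun t => (hF t).differentiableAt
  have hFs : ContDiff ℝ 1 F := by
    rw [contDiff_one_iff_deriv]
    exact ⟨hFd, by rwa [funext fun t => (hF t).deriv]⟩
  have hFL : ∀ a b, |F a - F b| ≤ C * |a - b| := by
    intro a b
    have := (convex_univ (𝕜 := ℝ) (E := ℝ)).norm_image_sub_le_of_norm_hasDerivWithin_le
      (f := F) (f' := F') (C := C) (fun x _ => (hF x).hasDerivWithinAt) (fun x _ => hC x)
      (mem_univ b) (mem_univ a)
    exact this
  have hmul : ∀ K, IsCompact K → K ⊆ Ω → IntegrableOn (fun x => F' (v x) * d x) K μ := by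
    intro K hK hKΩ
    refine (h.2.integrableOn_compact_subset hKΩ hK).bdd_mul (c := C) ?_
      (Eventually.of_forall fun x => hC _)
    exact hF'.comp_aestronglyMeasurable
      (h.1.integrableOn_compact_subset hKΩ hK).aestronglyMeasurable
  refine of_tendsto ?_ ?_ ?_
  · rw [locallyIntegrableOn_iff hΩ.isLocallyClosed]
    intro K hKΩ hK
    have hvK := h.1.integrableOn_compact_subset hKΩ hK
    have h0 : IntegrableOn (fun _ : E => F 0) K μ :=
      integrableOn_const hK.measure_lt_top.ne
    refine ((hvK.norm.const_mul C).add h0.norm).mono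
      (hFd.continuous.comp_aestronglyMeasurable hvK.aestronglyMeasurable)
      (Eventually.of_forall fun x => ?_)
    have h1 := hFL (v x) 0
    have h2 : |F (v x)| ≤ |F (v x) - F 0| + |F 0| := by
      simpa using abs_add_le (F (v x) - F 0) (F 0)
    simp only [Pi.add_apply, Real.norm_eq_abs]
    rw [sub_zero] at h1
    exact (h2.trans (by linarith)).trans (le_abs_self _)
  · rw [locallyIntegrableOn_iff hΩ.isLocallyClosed]
    exact fun K hKΩ hK => hmul K hK hKΩ
  · intro K hK hKΩ
    obtain ⟨s, hs, hsa, hs1, hs2⟩ := h.exists_smooth_approx hΩ hK hKΩ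
    have hdK := h.2.integrableOn_compact_subset hKΩ hK
    have hvK := h.1.integrableOn_compact_subset hKΩ hK
    refine ⟨fun j x => F (s j x), fun j x => F' (s j x) * fderiv ℝ (s j) x e,
      fun j => ?_, ?_, ?_⟩
    · refine (of_contDiff (μ := μ) Ω e (hFs.comp ((hs j).of_le (by simp)))).congr_right
        fun x => ?_
      rw [((hF (s j x)).comp_hasFDerivAt x
        ((hs j).differentiable (by simp) x).hasFDerivAt).fderiv]
      simp
    · have hlim : Tendsto (fun j => ENNReal.ofReal C * ∫⁻ x in K, ‖s j x - v x‖ₑ ∂μ)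
          atTop (𝓝 0) := by
        simpa using ENNReal.Tendsto.const_mul hs1 (Or.inr ENNReal.ofReal_ne_top)
      refine tendsto_of_tendsto_of_tendsto_of_le_of_le tendsto_const_nhds hlim
        (fun _ => zero_le) fun j => ?_
      rw [← lintegral_const_mul' _ _ ENNReal.ofReal_ne_top]
      refine lintegral_mono fun x => ?_
      rw [← ofReal_norm, ← ofReal_norm, ← ENNReal.ofReal_mul hC0]
      exact ENNReal.ofReal_le_ofReal (hFL _ _)
    · have hlim1 : Tendsto (fun j => ENNReal.ofReal C *
          ∫⁻ x in K, ‖fderiv ℝ (s j) x e - d x‖ₑ ∂μ) atTop (𝓝 0) := by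
        simpa using ENNReal.Tendsto.const_mul hs2 (Or.inr ENNReal.ofReal_ne_top)
      -- `F'` is merely continuous, so this term is handled by dominated convergence, using that the
      -- approximations converge almost everywhere.
      have hlim2 : Tendsto (fun j => ∫⁻ x in K, ‖(F' (s j x) - F' (v x)) * d x‖ₑ ∂μ)
          atTop (𝓝 0) := by
        have := tendsto_lintegral_of_dominated_convergence' (μ := μ.restrict K)
          (F := fun j x => ‖(F' (s j x) - F' (v x)) * d x‖ₑ) (f := fun _ => 0)
          (fun x => ENNReal.ofReal (2 * C) * ‖d x‖ₑ) (fun j => ?_) (fun j => ?_) ?_ ?_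
        · simpa using this
        · exact ((((hF'.comp (hs j).continuous).aestronglyMeasurable).sub
            (hF'.comp_aestronglyMeasurable hvK.aestronglyMeasurable)).mul
            hdK.aestronglyMeasurable).enorm
        · refine Eventually.of_forall fun x => ?_
          simp only [enorm_mul]
          gcongr
          rw [← ofReal_norm]
          refine ENNReal.ofReal_le_ofReal ((norm_sub_le _ _).trans ?_)
          rw [Real.norm_eq_abs, Real.norm_eq_abs]
          linarith [hC (s j x), hC (v x)]
        · rw [lintegral_const_mul' _ _ ENNReal.ofReal_ne_top]
          exact ENNReal.mul_ne_top ENNReal.ofReal_ne_top hdK.2.ne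
        · filter_upwards [hsa] with x hx
          have h1 : Tendsto (fun j => (F' (s j x) - F' (v x)) * d x) atTop (𝓝 0) := by
            simpa using (((hF'.tendsto (v x)).comp hx).sub_const (F' (v x))).mul_const (d x)
          simpa using h1.enorm
      have hlim := hlim1.add hlim2
      rw [add_zero] at hlim
      refine tendsto_of_tendsto_of_tendsto_of_le_of_le tendsto_const_nhds hlim (fun _ => zero_le) fun j => ?_
      rw [← lintegral_const_mul' _ _ ENNReal.ofReal_ne_top, ← lintegral_add_left']
      · refine lintegral_mono fun x => ?_
        have h1 : F' (s j x) * fderiv ℝ (s j) x e - F' (v x) * d x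
            = F' (s j x) * (fderiv ℝ (s j) x e - d x) + (F' (s j x) - F' (v x)) * d x := by ring
        simp only [h1]
        refine (enorm_add_le _ _).trans (add_le_add ?_ le_rfl)
        rw [enorm_mul]
        gcongr
        rw [← ofReal_norm]
        exact ENNReal.ofReal_le_ofReal (hC _)
      · exact (((hs j).continuous_fderiv_const e).aestronglyMeasurable.sub
          hdK.aestronglyMeasurable).enorm.const_mul _

/-- The weak derivative of the positive part. -/
theorem posPart (h : HasWeakDirDeriv μ Ω e v d) (hΩ : IsOpen Ω) :
    HasWeakDirDeriv μ Ω e (fun x => max (v x) 0) ({x | 0 < v x}.indicator d) := by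
  -- The ramps `G'` increase from `0` to `1` on `[0, 1/j]` and vanish at `0`, so their limit is the
  -- indicator of the open half-line. The weak derivative obtained is therefore zero on `{v = 0}`.
  set G' : ℕ → ℝ → ℝ := fun j t => max 0 (min 1 (j * t)) with hG'
  set G : ℕ → ℝ → ℝ := fun j t => ∫ s in (0 : ℝ)..t, G' j s with hG
  have hG'c : ∀ j, Continuous (G' j) := fun j => by fun_prop
  have hG'1 : ∀ j t, |G' j t| ≤ 1 := by
    intro j t
    rw [abs_of_nonneg (le_max_left _ _)]
    exact max_le zero_le_one (min_le_left _ _)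
  have hGd : ∀ j t, HasDerivAt (G j) (G' j t) t := fun j t =>
    (hG'c j).integral_hasStrictDerivAt 0 t |>.hasDerivAt
  have hG'lim : ∀ t, Tendsto (fun j => G' j t) atTop (𝓝 ({t : ℝ | 0 < t}.indicator 1 t)) := by
    intro t
    by_cases ht : 0 < t
    · rw [indicator_of_mem (by exact ht)]
      refine tendsto_const_nhds.congr' ?_
      obtain ⟨N, hN⟩ := exists_nat_gt (1 / t)
      filter_upwards [eventually_ge_atTop N] with j hj
      have : 1 ≤ (j : ℝ) * t := by
        rw [div_lt_iff₀ ht] at hN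
        have : (N : ℝ) ≤ j := by exact_mod_cast hj
        nlinarith
      simp [hG', min_eq_left this]
    · rw [indicator_of_notMem (by exact ht)]
      refine tendsto_const_nhds.congr fun j => ?_
      have : (j : ℝ) * t ≤ 0 := mul_nonpos_of_nonneg_of_nonpos (Nat.cast_nonneg j) (not_lt.1 ht)
      simp [hG', (min_le_right _ _).trans this]
  have hGlim : ∀ t, Tendsto (fun j => G j t) atTop (𝓝 (max t 0)) := by
    intro t
    have h1 : Tendsto (fun j => G j t) atTop
        (𝓝 (∫ s in (0 : ℝ)..t, {t : ℝ | 0 < t}.indicator 1 s)) := by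
      refine intervalIntegral.tendsto_integral_filter_of_dominated_convergence (fun _ => 1)
        (Eventually.of_forall fun j => (hG'c j).aestronglyMeasurable)
        (Eventually.of_forall fun j => Eventually.of_forall fun s _ => hG'1 j s)
        (by simp) (Eventually.of_forall fun s _ => hG'lim s)
    convert h1 using 2
    rcases le_total 0 t with ht | ht
    · rw [max_eq_left ht, intervalIntegral.integral_congr_ae (g := fun _ => (1 : ℝ))]
      · simp
      · refine Eventually.of_forall fun s hs => ?_
        rw [uIoc_of_le ht] at hs
        exact indicator_of_mem (by exact hs.1) _
    · rw [max_eq_right ht, intervalIntegral.integral_congr_ae (g := fun _ => (0 : ℝ))]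
      · simp
      · refine Eventually.of_forall fun s hs => ?_
        rw [uIoc_of_ge ht] at hs
        exact indicator_of_notMem (by simpa using hs.2) _
  have hGabs : ∀ j t, |G j t| ≤ |t| := by
    intro j t
    simpa using intervalIntegral.norm_integral_le_of_norm_le_const (a := 0) (b := t)
      (f := G' j) (C := 1) fun s _ => hG'1 j s
  have hdi : ∀ x, {x | 0 < v x}.indicator d x = {t : ℝ | 0 < t}.indicator 1 (v x) * d x := by
    intro x
    by_cases hx : 0 < v x <;> simp [indicator, hx]
  have hvm : ∀ K, IsCompact K → K ⊆ Ω → IntegrableOn ({x | 0 < v x}.indicator d) K μ := by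
    intro K hK hKΩ
    have hvK := h.1.integrableOn_compact_subset hKΩ hK
    have hdK := h.2.integrableOn_compact_subset hKΩ hK
    refine Integrable.mono hdK ?_ (Eventually.of_forall fun x => norm_indicator_le_norm_self _ _)
    refine hdK.aestronglyMeasurable.indicator₀ ?_
    exact nullMeasurableSet_lt aemeasurable_const hvK.aestronglyMeasurable.aemeasurable
  refine of_tendsto ?_ ?_ ?_
  · rw [locallyIntegrableOn_iff hΩ.isLocallyClosed]
    exact fun K hKΩ hK => (h.1.integrableOn_compact_subset hKΩ hK).pos_part
  · rw [locallyIntegrableOn_iff hΩ.isLocallyClosed]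
    exact fun K hKΩ hK => hvm K hK hKΩ
  · intro K hK hKΩ
    have hvK := h.1.integrableOn_compact_subset hKΩ hK
    have hdK := h.2.integrableOn_compact_subset hKΩ hK
    refine ⟨fun j x => G j (v x), fun j x => G' j (v x) * d x,
      fun j => h.comp hΩ (hGd j) (hG'c j) (hG'1 j), ?_, ?_⟩
    · have := tendsto_lintegral_of_dominated_convergence' (μ := μ.restrict K)
        (F := fun j x => ‖G j (v x) - max (v x) 0‖ₑ) (f := fun _ => 0)
        (fun x => 2 * ‖v x‖ₑ) (fun j => ?_) (fun j => ?_) ?_ ?_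
      · simpa using this
      · refine AEStronglyMeasurable.enorm (AEStronglyMeasurable.sub ?_
          hvK.pos_part.aestronglyMeasurable)
        have hGc : Continuous (G j) :=
          continuous_iff_continuousAt.2 fun t => (hGd j t).continuousAt
        exact hGc.comp_aestronglyMeasurable hvK.aestronglyMeasurable
      · refine Eventually.of_forall fun x => (enorm_sub_le).trans ?_
        simp only [two_mul]
        gcongr
        · rw [← ofReal_norm, ← ofReal_norm]
          exact ENNReal.ofReal_le_ofReal (hGabs j _)
        · rw [← ofReal_norm, ← ofReal_norm]
          refine ENNReal.ofReal_le_ofReal ?_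
          rw [Real.norm_eq_abs, abs_of_nonneg (le_max_right _ _)]
          exact max_le (le_abs_self _) (abs_nonneg _)
      · rw [lintegral_const_mul' _ _ (by simp)]
        exact ENNReal.mul_ne_top (by simp) hvK.2.ne
      · refine Eventually.of_forall fun x => ?_
        have h1 : Tendsto (fun j => G j (v x) - max (v x) 0) atTop (𝓝 0) := by
          simpa using (hGlim (v x)).sub_const (max (v x) 0)
        simpa using h1.enorm
    · have := tendsto_lintegral_of_dominated_convergence' (μ := μ.restrict K)
        (F := fun j x => ‖G' j (v x) * d x - {x | 0 < v x}.indicator d x‖ₑ) (f := fun _ => 0)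
        (fun x => 2 * ‖d x‖ₑ) (fun j => ?_) (fun j => ?_) ?_ ?_
      · simpa using this
      · exact ((((hG'c j).comp_aestronglyMeasurable hvK.aestronglyMeasurable).mul
          hdK.aestronglyMeasurable).sub (hvm K hK hKΩ).aestronglyMeasurable).enorm
      · refine Eventually.of_forall fun x => (enorm_sub_le).trans ?_
        simp only [two_mul]
        gcongr
        · rw [← ofReal_norm, ← ofReal_norm, norm_mul]
          refine ENNReal.ofReal_le_ofReal ?_
          exact mul_le_of_le_one_left (norm_nonneg _) (hG'1 j _)
        · exact enorm_indicator_le_enorm_self _ _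
      · rw [lintegral_const_mul' _ _ (by simp)]
        exact ENNReal.mul_ne_top (by simp) hdK.2.ne
      · refine Eventually.of_forall fun x => ?_
        have h1 : Tendsto (fun j => G' j (v x) * d x - {x | 0 < v x}.indicator d x) atTop
            (𝓝 0) := by
          rw [hdi]
          simpa using ((hG'lim (v x)).mul_const (d x)).sub_const
            ({t : ℝ | 0 < t}.indicator 1 (v x) * d x)
        simpa using h1.enorm

end HasWeakDirDeriv

/-! ### Translation estimates in `L¹` -/

section Translation

variable [FiniteDimensional ℝ E] [μ.IsAddHaarMeasure]

/-- The increment is the integral of the derivative along the segment from `x` to `x + h`. By Fubini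
one integrates over `x` first, and each translate of the small ball by `t • h` stays in the larger
one. -/
theorem ContDiff.lintegral_enorm_translate_sub_le {s : E → ℝ} (hs : ContDiff ℝ ∞ s) (c h : E)
    (r : ℝ) : ∫⁻ x in Metric.ball c r, ‖s (x + h) - s x‖ₑ ∂μ
      ≤ ∫⁻ x in Metric.closedBall c (r + ‖h‖), ‖fderiv ℝ s x h‖ₑ ∂μ := by
  have hD := hs.continuous_fderiv_const h
  have hpt : ∀ x, ‖s (x + h) - s x‖ₑ
      ≤ ∫⁻ t in Ioc (0 : ℝ) 1, ‖fderiv ℝ s (x + t • h) h‖ₑ := by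
    intro x
    have hder : ∀ t : ℝ, HasDerivAt (fun t : ℝ => s (x + t • h)) (fderiv ℝ s (x + t • h) h) t := by
      intro t
      have h1 : HasDerivAt (fun t : ℝ => x + t • h) h t := by
        simpa using ((hasDerivAt_id t).smul_const h).const_add x
      exact (hs.differentiable (by simp) (x + t • h)).hasFDerivAt.comp_hasDerivAt t h1
    have hcont : Continuous fun t : ℝ => fderiv ℝ s (x + t • h) h :=
      hD.comp (by fun_prop)
    have h2 := intervalIntegral.integral_eq_sub_of_hasDerivAt (fun t _ => hder t)
      (hcont.intervalIntegrable 0 1)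
    simp only [one_smul, zero_smul, add_zero] at h2
    rw [← h2, intervalIntegral.integral_of_le zero_le_one]
    exact enorm_integral_le_lintegral_enorm _
  have hjoint : Continuous fun q : E × ℝ => ‖fderiv ℝ s (q.1 + q.2 • h) h‖ₑ :=
    (hD.comp (by fun_prop)).enorm
  calc ∫⁻ x in Metric.ball c r, ‖s (x + h) - s x‖ₑ ∂μ
      ≤ ∫⁻ x in Metric.ball c r, ∫⁻ t in Ioc (0 : ℝ) 1, ‖fderiv ℝ s (x + t • h) h‖ₑ ∂volume ∂μ :=
        lintegral_mono hpt
    _ = ∫⁻ t in Ioc (0 : ℝ) 1, ∫⁻ x in Metric.ball c r, ‖fderiv ℝ s (x + t • h) h‖ₑ ∂μ :=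
        lintegral_lintegral_swap hjoint.measurable.aemeasurable
    _ ≤ ∫⁻ t in Ioc (0 : ℝ) 1, ∫⁻ x in Metric.closedBall c (r + ‖h‖), ‖fderiv ℝ s x h‖ₑ ∂μ := by
        refine setLIntegral_mono' measurableSet_Ioc fun t ht => ?_
        rw [← lintegral_indicator measurableSet_ball,
          ← lintegral_indicator Metric.isClosed_closedBall.measurableSet,
          ← lintegral_add_right_eq_self
            ((Metric.closedBall c (r + ‖h‖)).indicator fun x => ‖fderiv ℝ s x h‖ₑ) (t • h)]
        refine lintegral_mono fun x => ?_
        by_cases hx : x ∈ Metric.ball c r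
        · have hx' : x + t • h ∈ Metric.closedBall c (r + ‖h‖) := by
            rw [mem_ball_iff_norm] at hx
            rw [mem_closedBall_iff_norm]
            have h3 : ‖t • h‖ ≤ ‖h‖ := by
              rw [norm_smul, Real.norm_of_nonneg ht.1.le]
              exact mul_le_of_le_one_left (norm_nonneg _) ht.2
            calc ‖x + t • h - c‖ = ‖(x - c) + t • h‖ := by congr 1; abel
              _ ≤ ‖x - c‖ + ‖t • h‖ := norm_add_le _ _
              _ ≤ r + ‖h‖ := by linarith
          rw [indicator_of_mem hx, indicator_of_mem hx']
        · rw [indicator_of_notMem hx]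
          exact zero_le
    _ = ∫⁻ x in Metric.closedBall c (r + ‖h‖), ‖fderiv ℝ s x h‖ₑ ∂μ := by simp

/-- Translations of a weakly differentiable function are controlled in `L¹` by its derivative. -/
theorem HasWeakDirDeriv.lintegral_enorm_translate_sub_le {Ω : Set E} {h : E} {f d : E → ℝ}
    (hf : HasWeakDirDeriv μ Ω h f d) (hΩ : IsOpen Ω) {c : E} {r : ℝ}
    (hr : Metric.closedBall c (r + ‖h‖) ⊆ Ω) :
    ∫⁻ x in Metric.ball c r, ‖f (x + h) - f x‖ₑ ∂μ
      ≤ ∫⁻ x in Metric.closedBall c (r + ‖h‖), ‖d x‖ₑ ∂μ := by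
  set K := Metric.closedBall c (r + ‖h‖) with hKdef
  have hK : IsCompact K := isCompact_closedBall _ _
  obtain ⟨s, hs, -, hs1, hs2⟩ := hf.exists_smooth_approx hΩ hK hr
  have hBK : Metric.ball c r ⊆ K :=
    Metric.ball_subset_closedBall.trans
      (Metric.closedBall_subset_closedBall (by linarith [norm_nonneg h]))
  have hfK := hf.1.integrableOn_compact_subset hr hK
  have hdK := hf.2.integrableOn_compact_subset hr hK
  have hshift : ∀ j, ∫⁻ x in Metric.ball c r, ‖f (x + h) - s j (x + h)‖ₑ ∂μ
      ≤ ∫⁻ x in K, ‖s j x - f x‖ₑ ∂μ := by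
    intro j
    rw [← lintegral_indicator measurableSet_ball, ← lintegral_indicator hK.measurableSet,
      ← lintegral_add_right_eq_self (K.indicator fun x => ‖s j x - f x‖ₑ) h]
    refine lintegral_mono fun x => ?_
    by_cases hx : x ∈ Metric.ball c r
    · have hx' : x + h ∈ K := by
        rw [mem_ball_iff_norm] at hx
        rw [hKdef, mem_closedBall_iff_norm]
        calc ‖x + h - c‖ = ‖(x - c) + h‖ := by congr 1; abel
          _ ≤ ‖x - c‖ + ‖h‖ := norm_add_le _ _
          _ ≤ r + ‖h‖ := by linarith
      rw [indicator_of_mem hx, indicator_of_mem hx', enorm_sub_rev]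
    · rw [indicator_of_notMem hx]
      exact zero_le
  have hbound : ∀ j, ∫⁻ x in Metric.ball c r, ‖f (x + h) - f x‖ₑ ∂μ
      ≤ (∫⁻ x in K, ‖fderiv ℝ (s j) x h - d x‖ₑ ∂μ + ∫⁻ x in K, ‖d x‖ₑ ∂μ)
        + (∫⁻ x in K, ‖s j x - f x‖ₑ ∂μ + ∫⁻ x in K, ‖s j x - f x‖ₑ ∂μ) := by
    intro j
    have hsc := (hs j).continuous
    calc ∫⁻ x in Metric.ball c r, ‖f (x + h) - f x‖ₑ ∂μ
        ≤ ∫⁻ x in Metric.ball c r, (‖s j (x + h) - s j x‖ₑ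
            + (‖f (x + h) - s j (x + h)‖ₑ + ‖s j x - f x‖ₑ)) ∂μ := by
          refine lintegral_mono fun x => ?_
          have h1 : f (x + h) - f x = (s j (x + h) - s j x)
              + ((f (x + h) - s j (x + h)) + (s j x - f x)) := by ring
          simp only [h1]
          exact (enorm_add_le _ _).trans (by gcongr; exact enorm_add_le _ _)
      _ = ∫⁻ x in Metric.ball c r, ‖s j (x + h) - s j x‖ₑ ∂μ
            + (∫⁻ x in Metric.ball c r, ‖f (x + h) - s j (x + h)‖ₑ ∂μ
              + ∫⁻ x in Metric.ball c r, ‖s j x - f x‖ₑ ∂μ) := by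
          rw [lintegral_add_left, lintegral_add_right']
          · exact (hsc.aestronglyMeasurable.sub (hfK.mono_set hBK).aestronglyMeasurable).enorm
          · exact ((hsc.comp (continuous_add_const h)).sub hsc).measurable.enorm
      _ ≤ _ := by
          gcongr ?_ + (?_ + ?_)
          · refine ((hs j).lintegral_enorm_translate_sub_le c h r).trans ?_
            rw [← lintegral_add_right' _ hdK.aestronglyMeasurable.enorm]
            refine lintegral_mono fun x => ?_
            have h1 : fderiv ℝ (s j) x h = (fderiv ℝ (s j) x h - d x) + d x := by ring
            conv_lhs => rw [h1]
            exact enorm_add_le _ _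
          · exact hshift j
          · exact lintegral_mono_set hBK
  have hlim := (hs2.add_const (∫⁻ x in K, ‖d x‖ₑ ∂μ)).add (hs1.add hs1)
  simp only [zero_add, add_zero] at hlim
  exact ge_of_tendsto' hlim hbound

end Translation

end WeakDerivCalculus

/-! ### Weak gradients: Poincaré and isoperimetric inequalities -/

section WeakGradient

open scoped ContDiff ENNReal

variable {E : Type*} [NormedAddCommGroup E] [InnerProductSpace ℝ E] [FiniteDimensional ℝ E]
  [MeasurableSpace E] [BorelSpace E] {μ : Measure E} [μ.IsAddHaarMeasure]

/-- `v` has the locally integrable weak gradient `g` in `Ω`. -/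
def HasWeakGrad (μ : Measure E) (Ω : Set E) (v : E → ℝ) (g : E → E) : Prop :=
  ∀ e, HasWeakDirDeriv μ Ω e v fun x => inner ℝ (g x) e

namespace HasWeakGrad

variable {Ω : Set E} {f f' : E → ℝ} {G G' : E → E}

theorem sub (h : HasWeakGrad μ Ω f G) (h' : HasWeakGrad μ Ω f' G') :
    HasWeakGrad μ Ω (fun x => f x - f' x) (fun x => G x - G' x) := fun e =>
  ((h e).sub (h' e)).congr_right fun _ => (inner_sub_left _ _ _).symm

theorem neg (h : HasWeakGrad μ Ω f G) : HasWeakGrad μ Ω (fun x => -f x) (fun x => -G x) :=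
  fun e => (h e).neg.congr_right fun _ => (inner_neg_left _ _).symm

theorem of_contDiff (Ω : Set E) {ψ : E → ℝ} (hψ : ContDiff ℝ ∞ ψ) :
    HasWeakGrad μ Ω ψ (gradient ψ) := fun e =>
  (HasWeakDirDeriv.of_contDiff Ω e (hψ.of_le (by simp))).congr_right fun _ => by
    rw [gradient, InnerProductSpace.toDual_symm_apply]

theorem posPart (h : HasWeakGrad μ Ω f G) (hΩ : IsOpen Ω) :
    HasWeakGrad μ Ω (fun x => max (f x) 0) ({x | 0 < f x}.indicator G) := fun e =>
  ((h e).posPart hΩ).congr_right fun x => by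
    by_cases hx : 0 < f x <;> simp [indicator, hx]

/-- Averaging over all `h` in a ball is useful because, after exchanging the integrals, each value
`f x` is compared with the values of `f` on a whole ball around `x`. Both inequalities below start
from this. -/
theorem lintegral_lintegral_translate_sub_le (hf : HasWeakGrad μ Ω f G) (hΩ : IsOpen Ω) {c : E}
    {r ρ : ℝ} (hr : Metric.closedBall c (r + ρ) ⊆ Ω) :
    ∫⁻ h in Metric.ball 0 ρ, ∫⁻ x in Metric.ball c r, ‖f (x + h) - f x‖ₑ ∂μ ∂μ
      ≤ μ (Metric.ball 0 ρ) * (ENNReal.ofReal ρ * ∫⁻ x in Metric.closedBall c (r + ρ), ‖G x‖ₑ ∂μ) := by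
  rw [mul_comm (μ _), ← setLIntegral_const]
  refine setLIntegral_mono' measurableSet_ball fun h hh => ?_
  rw [mem_ball_zero_iff] at hh
  have hsub : Metric.closedBall c (r + ‖h‖) ⊆ Metric.closedBall c (r + ρ) :=
    Metric.closedBall_subset_closedBall (by linarith)
  refine ((hf h).lintegral_enorm_translate_sub_le hΩ (hsub.trans hr)).trans ?_
  rw [← lintegral_const_mul' _ _ ENNReal.ofReal_ne_top]
  refine (lintegral_mono_set hsub).trans (lintegral_mono fun x => ?_)
  rw [← ofReal_norm, ← ofReal_norm, ← ENNReal.ofReal_mul ((norm_nonneg h).trans hh.le), mul_comm]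
  refine ENNReal.ofReal_le_ofReal ((norm_inner_le_norm _ _).trans ?_)
  gcongr

/-- Functions vanishing outside a set of small measure: the `L¹` norm is controlled by the
gradient with a small constant. -/
theorem lintegral_enorm_le_of_measure_ne_zero_le (hf : HasWeakGrad μ Ω f G) (hΩ : IsOpen Ω)
    (hfm : Measurable f) {c : E} {r ρ : ℝ} (hρ : 0 < ρ) (hr : Metric.closedBall c (r + ρ) ⊆ Ω)
    (hsupp : μ {x | f x ≠ 0} ≤ μ (Metric.ball 0 ρ) / 2) :
    ∫⁻ x in Metric.ball c r, ‖f x‖ₑ ∂μ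
      ≤ 2 * (ENNReal.ofReal ρ * ∫⁻ x in Metric.closedBall c (r + ρ), ‖G x‖ₑ ∂μ) := by
  set M := μ (Metric.ball (0 : E) ρ) with hM
  have hM0 : M ≠ 0 := (Metric.measure_ball_pos μ 0 hρ).ne'
  have hMt : M ≠ ⊤ := measure_ball_lt_top.ne
  have h1 := hf.lintegral_lintegral_translate_sub_le hΩ hr
  have hmeas : Measurable (Function.uncurry fun h x : E => ‖f (x + h) - f x‖ₑ) :=
    ((hfm.comp (measurable_snd.add measurable_fst)).sub (hfm.comp measurable_snd)).enorm
  rw [lintegral_lintegral_swap hmeas.aemeasurable] at h1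
  have h2 : ∀ x, M / 2 * ‖f x‖ₑ ≤ ∫⁻ h in Metric.ball 0 ρ, ‖f (x + h) - f x‖ₑ ∂μ := by
    intro x
    set Z : Set E := {h | f (x + h) ≠ 0} with hZ
    have hZm : MeasurableSet Z :=
      (hfm.comp (measurable_const_add x)) (measurableSet_singleton 0).compl
    have hZμ : μ Z ≤ M / 2 := by
      refine le_trans (le_of_eq ?_) hsupp
      exact measure_preimage_add μ x {x | f x ≠ 0}
    -- For at least half of the vectors `h` in the ball, `f (x + h) = 0`, so the increment is
    -- exactly `|f x|`.
    have h3 : M / 2 ≤ μ (Metric.ball 0 ρ \ Z) := by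
      have h4 : M ≤ μ Z + μ (Metric.ball 0 ρ \ Z) := by
        refine (measure_mono ?_).trans (measure_union_le _ _)
        intro y hy
        by_cases hyZ : y ∈ Z
        · exact Or.inl hyZ
        · exact Or.inr ⟨hy, hyZ⟩
      have h5 : M / 2 + M / 2 ≤ M / 2 + μ (Metric.ball 0 ρ \ Z) := by
        rw [ENNReal.add_halves]
        exact h4.trans (by gcongr)
      exact (ENNReal.add_le_add_iff_left (ENNReal.div_ne_top hMt (by simp))).1 h5
    calc M / 2 * ‖f x‖ₑ ≤ ‖f x‖ₑ * μ (Metric.ball 0 ρ \ Z) := by rw [mul_comm]; gcongr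
      _ = ∫⁻ _ in Metric.ball 0 ρ \ Z, ‖f x‖ₑ ∂μ := (setLIntegral_const _ _).symm
      _ ≤ ∫⁻ h in Metric.ball 0 ρ \ Z, ‖f (x + h) - f x‖ₑ ∂μ := by
          refine setLIntegral_mono' (measurableSet_ball.diff hZm) fun h hh => ?_
          have : f (x + h) = 0 := by
            by_contra hne
            exact hh.2 hne
          simp [this]
      _ ≤ _ := lintegral_mono_set sdiff_subset
  have h3 : M / 2 * ∫⁻ x in Metric.ball c r, ‖f x‖ₑ ∂μ
      ≤ M / 2 * (2 * (ENNReal.ofReal ρ * ∫⁻ x in Metric.closedBall c (r + ρ), ‖G x‖ₑ ∂μ)) := by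
    rw [← lintegral_const_mul' _ _ (ENNReal.div_ne_top hMt (by simp)), ← mul_assoc,
      ENNReal.div_mul_cancel (by simp) (by simp)]
    exact (lintegral_mono h2).trans h1
  exact (ENNReal.mul_le_mul_iff_right (ENNReal.div_pos hM0 (by simp)).ne'
    (ENNReal.div_ne_top hMt (by simp))).1 h3

/-- An isoperimetric inequality: a function that differs by at least `t` between two subsets of a
ball has a large gradient in a larger ball. -/
theorem ofReal_mul_measure_mul_measure_le (hf : HasWeakGrad μ Ω f G) (hΩ : IsOpen Ω)
    (hfm : Measurable f) {c : E} {r ρ : ℝ} (hrρ : 2 * r ≤ ρ)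
    (hr : Metric.closedBall c (r + ρ) ⊆ Ω) {A B : Set E} (hA : MeasurableSet A)
    (hB : MeasurableSet B) (hAr : A ⊆ Metric.ball c r) (hBr : B ⊆ Metric.ball c r) {t : ℝ}
    (ht : ∀ x ∈ A, ∀ y ∈ B, t ≤ |f y - f x|) :
    ENNReal.ofReal t * μ A * μ B ≤ μ (Metric.ball 0 ρ) *
      (ENNReal.ofReal ρ * ∫⁻ x in Metric.closedBall c (r + ρ), ‖G x‖ₑ ∂μ) := by
  have h1 := hf.lintegral_lintegral_translate_sub_le hΩ hr
  have hmeas : Measurable (Function.uncurry fun h x : E => ‖f (x + h) - f x‖ₑ) :=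
    ((hfm.comp (measurable_snd.add measurable_fst)).sub (hfm.comp measurable_snd)).enorm
  rw [lintegral_lintegral_swap hmeas.aemeasurable] at h1
  refine le_trans ?_ h1
  calc ENNReal.ofReal t * μ A * μ B = ∫⁻ _ in A, ENNReal.ofReal t * μ B ∂μ := by
        rw [setLIntegral_const]; ring
    _ ≤ ∫⁻ x in A, ∫⁻ h in Metric.ball 0 ρ, ‖f (x + h) - f x‖ₑ ∂μ ∂μ := by
        refine setLIntegral_mono' hA fun x hx => ?_
        -- Differences of two points of `B_r` have length below `2 * r ≤ ρ`, so the whole translate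
        -- of `B` is seen.
        set Z : Set E := {h | x + h ∈ B} with hZ
        have hZm : MeasurableSet Z := measurable_const_add x hB
        have hZμ : μ Z = μ B := measure_preimage_add μ x B
        have hZρ : Z ⊆ Metric.ball 0 ρ := by
          intro h hh
          have h2 := hBr hh
          have h3 := hAr hx
          rw [mem_ball_iff_norm] at h2 h3
          rw [mem_ball_zero_iff]
          calc ‖h‖ = ‖(x + h - c) - (x - c)‖ := by congr 1; abel
            _ ≤ ‖x + h - c‖ + ‖x - c‖ := norm_sub_le _ _
            _ < ρ := by linarith
        rw [← hZμ, ← setLIntegral_const]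
        refine (setLIntegral_mono' hZm fun h hh => ?_).trans (lintegral_mono_set hZρ)
        rw [← ofReal_norm]
        exact ENNReal.ofReal_le_ofReal (ht x hx _ hh)
    _ ≤ _ := lintegral_mono_set hAr

end HasWeakGrad

end WeakGradient

theorem locallyIntegrableOn_of_memLp {X β : Type*} [TopologicalSpace X] [R1Space X]
    [LocallyCompactSpace X] [MeasurableSpace X] [NormedAddCommGroup β] {μ : Measure X}
    [IsFiniteMeasureOnCompacts μ] {p : ℝ} (hp : 1 ≤ p) {Ω : Set X}
    (hΩ : IsOpen Ω) {f : X → β}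
    (hf : ∀ K, IsCompact K → K ⊆ Ω → MemLp f (ENNReal.ofReal p) (μ.restrict K)) :
    LocallyIntegrableOn f Ω μ := by
  rw [locallyIntegrableOn_iff hΩ.isLocallyClosed]
  intro K hKΩ hK
  have : IsFiniteMeasure (μ.restrict K) := ⟨by simpa using hK.measure_lt_top⟩
  exact (hf K hK hKΩ).integrable (by simpa using ENNReal.ofReal_le_ofReal hp)

-- The weak derivative is linear in the direction, so the coordinate directions determine the
-- others. Test functions vanish outside `Ω`, which permits integrals over the whole space.
open scoped ContDiff in
theorem HasWeakGradLoc.hasWeakGrad {n : ℕ} {p : ℝ} (hp : 1 ≤ p)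
    {Ω : Set (EuclideanSpace ℝ (Fin n))} (hΩ : IsOpen Ω)
    {v : EuclideanSpace ℝ (Fin n) → ℝ} {g : EuclideanSpace ℝ (Fin n) → EuclideanSpace ℝ (Fin n)}
    (h : HasWeakGradLoc p Ω v g) : HasWeakGrad volume Ω v g := by
  have hv := locallyIntegrableOn_of_memLp hp hΩ h.memLp
  have hg := locallyIntegrableOn_of_memLp hp hΩ h.memLp_grad
  have hge : ∀ e, LocallyIntegrableOn (fun x => inner ℝ (g x) e) Ω volume := by
    intro e
    rw [locallyIntegrableOn_iff hΩ.isLocallyClosed] at hg ⊢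
    exact fun K hKΩ hK => Integrable.inner_const (𝕜 := ℝ) (hg K hKΩ hK) e
  intro e
  refine ⟨hv, hge e, fun φ hφ hφc hφΩ => ?_⟩
  have hφ0 : ∀ x, x ∉ Ω → φ x = 0 := fun x hx =>
    image_eq_zero_of_notMem_tsupport fun h => hx (hφΩ h)
  have hdφ0 : ∀ x, x ∉ Ω → fderiv ℝ φ x = 0 := by
    intro x hx
    by_contra hne
    exact hx (hφΩ (support_fderiv_subset ℝ hne))
  have hbasis : ∀ i : Fin n, ∫ x, v x * fderiv ℝ φ x (EuclideanSpace.single i 1)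
      = -∫ x, φ x * g x i := by
    intro i
    have := h.integral_eq φ hφ hφc hφΩ i
    rwa [setIntegral_eq_integral_of_forall_compl_eq_zero fun x hx => by simp [hdφ0 x hx],
      setIntegral_eq_integral_of_forall_compl_eq_zero fun x hx => by simp [hφ0 x hx]] at this
  have he : e = ∑ i, e i • EuclideanSpace.single i (1 : ℝ) := by
    ext j
    simp [Finset.sum_apply, Pi.single_apply]
  have hL : ∀ x, v x * fderiv ℝ φ x e
      = ∑ i, e i * (v x * fderiv ℝ φ x (EuclideanSpace.single i 1)) := by
    intro x
    conv_lhs => rw [he]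
    rw [map_sum, Finset.mul_sum]
    refine Finset.sum_congr rfl fun i _ => ?_
    rw [map_smul, smul_eq_mul]
    ring
  have hR : ∀ x, φ x * inner ℝ (g x) e = ∑ i, e i * (φ x * g x i) := by
    intro x
    rw [PiLp.inner_apply, Finset.mul_sum]
    refine Finset.sum_congr rfl fun i _ => ?_
    simp
    ring
  simp_rw [hL, hR]
  rw [integral_finsetSum, integral_finsetSum, ← Finset.sum_neg_distrib]
  · refine Finset.sum_congr rfl fun i _ => ?_
    rw [integral_const_mul, integral_const_mul, hbasis, mul_neg]
  · intro i _
    have h1 := (hge (EuclideanSpace.single i 1)).integrable_mul_of_tsupport_subset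
      hφ.continuous hφc hφΩ
    refine (h1.congr (Eventually.of_forall fun x => ?_)).const_mul _
    simp [PiLp.inner_apply, mul_comm]
  · intro i _
    exact (hv.integrable_mul_fderiv_of_tsupport_subset hφ hφc hφΩ _).const_mul _

/-! ### Minimizers and the energy comparison -/

section Minimizers

open scoped ContDiff ENNReal

variable {n : ℕ}

theorem HasWeakGradLoc.congr_ae {p : ℝ} {Ω : Set (EuclideanSpace ℝ (Fin n))} {v v' : EuclideanSpace ℝ (Fin n) → ℝ} {g g' : EuclideanSpace ℝ (Fin n) → EuclideanSpace ℝ (Fin n)}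
    (h : HasWeakGradLoc p Ω v g) (hv : v =ᵐ[volume.restrict Ω] v')
    (hg : g =ᵐ[volume.restrict Ω] g') : HasWeakGradLoc p Ω v' g' := by
  refine ⟨fun K hK hKΩ => ?_, fun K hK hKΩ => ?_, fun φ hφ hφc hφΩ i => ?_⟩
  · exact (memLp_congr_ae (ae_restrict_of_ae_restrict_of_subset hKΩ hv)).1 (h.memLp K hK hKΩ)
  · exact (memLp_congr_ae (ae_restrict_of_ae_restrict_of_subset hKΩ hg)).1 (h.memLp_grad K hK hKΩ)
  · have h1 : ∫ x in Ω, v x * fderiv ℝ φ x (EuclideanSpace.single i 1)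
        = ∫ x in Ω, v' x * fderiv ℝ φ x (EuclideanSpace.single i 1) := by
      refine integral_congr_ae ?_
      filter_upwards [hv] with x hx
      rw [hx]
    have h2 : ∫ x in Ω, φ x * g x i = ∫ x in Ω, φ x * g' x i := by
      refine integral_congr_ae ?_
      filter_upwards [hg] with x hx
      rw [hx]
    rw [← h1, ← h2]
    exact h.integral_eq φ hφ hφc hφΩ i

theorem HasWeakGrad.hasWeakGradLoc {p : ℝ} {Ω : Set (EuclideanSpace ℝ (Fin n))} {v : EuclideanSpace ℝ (Fin n) → ℝ} {g : EuclideanSpace ℝ (Fin n) → EuclideanSpace ℝ (Fin n)}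
    (h : HasWeakGrad volume Ω v g)
    (hv : ∀ K, IsCompact K → K ⊆ Ω → MemLp v (ENNReal.ofReal p) (volume.restrict K))
    (hg : ∀ K, IsCompact K → K ⊆ Ω → MemLp g (ENNReal.ofReal p) (volume.restrict K)) :
    HasWeakGradLoc p Ω v g := by
  refine ⟨hv, hg, fun φ hφ hφc hφΩ i => ?_⟩
  have := (h (EuclideanSpace.single i 1)).integral_eq φ hφ hφc hφΩ
  have hφ0 : ∀ x, x ∉ Ω → φ x = 0 := fun x hx =>
    image_eq_zero_of_notMem_tsupport fun h => hx (hφΩ h)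
  have hdφ0 : ∀ x, x ∉ Ω → fderiv ℝ φ x = 0 := by
    intro x hx
    by_contra hne
    exact hx (hφΩ (support_fderiv_subset ℝ hne))
  rw [setIntegral_eq_integral_of_forall_compl_eq_zero fun x hx => by simp [hdφ0 x hx],
    setIntegral_eq_integral_of_forall_compl_eq_zero fun x hx => by simp [hφ0 x hx], this]
  congr 2 with x
  simp [EuclideanSpace.inner_single_right]

/-- `u`, with gradient `g`, is an everywhere defined measurable minimizer with values in
`[-1, 1]`. -/
structure IsMeasurableGLMinimizer (p : ℝ) (F : EuclideanSpace ℝ (Fin n) → ℝ → EuclideanSpace ℝ (Fin n) → ℝ) (W : ℝ → EuclideanSpace ℝ (Fin n) → ℝ) (Ω : Set (EuclideanSpace ℝ (Fin n)))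
    (u : EuclideanSpace ℝ (Fin n) → ℝ) (g : EuclideanSpace ℝ (Fin n) → EuclideanSpace ℝ (Fin n)) : Prop where
  measurable : Measurable u
  measurable_grad : Measurable g
  mem_Icc : ∀ x, u x ∈ Icc (-1 : ℝ) 1
  hasWeakGradLoc : HasWeakGradLoc p Ω u g
  energy_le : ∀ Ω' : Set (EuclideanSpace ℝ (Fin n)), IsOpen Ω' → IsCompact (closure Ω') → closure Ω' ⊆ Ω →
    ∀ (v : EuclideanSpace ℝ (Fin n) → ℝ) (gv : EuclideanSpace ℝ (Fin n) → EuclideanSpace ℝ (Fin n)), HasWeakGradLoc p Ω v gv → (∀ x, v x ∈ Icc (-1 : ℝ) 1) →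
      (∀ x ∉ Ω', v x = u x) → glEnergy F W u g Ω' ≤ glEnergy F W v gv Ω'

/-- Clamping a measurable representative to `[-1, 1]` makes the constraints hold everywhere and the
level sets Borel, so that competitors can be built pointwise. -/
theorem IsGLMinimizer.exists_measurable {p : ℝ} (hp : 1 ≤ p) {F : EuclideanSpace ℝ (Fin n) → ℝ → EuclideanSpace ℝ (Fin n) → ℝ} {W : ℝ → EuclideanSpace ℝ (Fin n) → ℝ}
    {Ω : Set (EuclideanSpace ℝ (Fin n))} (hΩ : IsOpen Ω) {u : EuclideanSpace ℝ (Fin n) → ℝ} (hu : IsGLMinimizer p F W Ω u) :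
    ∃ u₀ g₀, IsMeasurableGLMinimizer p F W Ω u₀ g₀ ∧ u =ᵐ[volume.restrict Ω] u₀ := by
  obtain ⟨hIcc, g, hg, hmin⟩ := hu
  have hum := (locallyIntegrableOn_of_memLp hp hΩ hg.memLp).aestronglyMeasurable.aemeasurable
  have hgm := (locallyIntegrableOn_of_memLp hp hΩ hg.memLp_grad).aestronglyMeasurable.aemeasurable
  set u₀ : EuclideanSpace ℝ (Fin n) → ℝ := fun x => max (-1) (min 1 (hum.mk u x)) with hu₀
  have huu₀ : u =ᵐ[volume.restrict Ω] u₀ := by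
    filter_upwards [hum.ae_eq_mk, hIcc] with x hx hx'
    rw [hu₀]
    simp only
    rw [← hx, min_eq_right hx'.2, max_eq_right hx'.1]
  have hgg₀ := hgm.ae_eq_mk
  refine ⟨u₀, hgm.mk g, ⟨?_, hgm.measurable_mk, ?_, hg.congr_ae huu₀ hgg₀, ?_⟩, huu₀⟩
  · exact measurable_const.max (measurable_const.min hum.measurable_mk)
  · exact fun x => ⟨le_max_left _ _, max_le (by norm_num) (min_le_left _ _)⟩
  · intro Ω' hΩ' hc hΩ'Ω v gv hv hvI hvu
    have h1 : glEnergy F W u₀ (hgm.mk g) Ω' = glEnergy F W u g Ω' := by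
      have hsub : Ω' ⊆ Ω := subset_closure.trans hΩ'Ω
      refine lintegral_congr_ae ?_
      filter_upwards [ae_restrict_of_ae_restrict_of_subset hsub huu₀,
        ae_restrict_of_ae_restrict_of_subset hsub hgg₀] with x hx hx'
      rw [hx, hx']
    rw [h1]
    refine hmin Ω' hΩ' hc hΩ'Ω v gv hv (Eventually.of_forall hvI) ?_
    filter_upwards [ae_restrict_of_ae_restrict_of_subset (sdiff_subset (t := Ω')) huu₀,
      ae_restrict_mem (hΩ.measurableSet.diff hΩ'.measurableSet)] with x hx hxm
    rw [hx, hvu x hxm.2]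

theorem continuous_gradient_of_contDiff {ψ : EuclideanSpace ℝ (Fin n) → ℝ} (hψ : ContDiff ℝ ∞ ψ) :
    Continuous (gradient ψ) :=
  (InnerProductSpace.toDual ℝ (EuclideanSpace ℝ (Fin n))).symm.continuous.comp (hψ.continuous_fderiv (by simp))

namespace IsMeasurableGLMinimizer

variable {p m lam : ℝ} {F : EuclideanSpace ℝ (Fin n) → ℝ → EuclideanSpace ℝ (Fin n) → ℝ} {W : ℝ → EuclideanSpace ℝ (Fin n) → ℝ} {Ω : Set (EuclideanSpace ℝ (Fin n))} {u : EuclideanSpace ℝ (Fin n) → ℝ} {g : EuclideanSpace ℝ (Fin n) → EuclideanSpace ℝ (Fin n)}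

/-- The weak gradient of `(ψ - (1 - u))⁺`. -/
theorem hasWeakGrad_posPart (hu : IsMeasurableGLMinimizer p F W Ω u g) (hp : 1 ≤ p)
    (hΩ : IsOpen Ω) {ψ : EuclideanSpace ℝ (Fin n) → ℝ} (hψ : ContDiff ℝ ∞ ψ) :
    HasWeakGrad volume Ω (fun x => max (ψ x - (1 - u x)) 0)
      ({x | 1 - u x < ψ x}.indicator fun x => gradient ψ x + g x) := by
  have h1 := hu.hasWeakGradLoc.hasWeakGrad hp hΩ
  have h2 : HasWeakGrad volume Ω (fun x => ψ x - 1) (gradient fun x => ψ x - 1) :=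
    HasWeakGrad.of_contDiff Ω (hψ.sub contDiff_const)
  have h3 := (h2.sub h1.neg).posPart hΩ
  have e1 : (fun x => ψ x - 1 - -u x) = fun x => ψ x - (1 - u x) := by
    ext x; ring
  have e2 : (gradient fun x => ψ x - 1) = gradient ψ := by
    ext1 x
    simp [gradient, fderiv_sub_const]
  rw [e2] at h3
  have e3 : {x | 0 < ψ x - 1 - -u x} = {x | 1 - u x < ψ x} := by
    ext x
    simp only [mem_ofPred_eq]
    constructor <;> intro h <;> linarith
  rw [e3] at h3
  have e4 : (fun x => gradient ψ x - -g x) = fun x => gradient ψ x + g x := by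
    ext1 x; simp
  rw [e4] at h3
  intro e
  have := h3 e
  rwa [show (fun x => max (ψ x - 1 - -u x) 0) = fun x => max (ψ x - (1 - u x)) 0 from by
    ext x; congr 1; ring] at this

/-- Finiteness allows the energy outside the modified set to be cancelled from both sides of the
minimality inequality. -/
theorem glEnergy_ne_top (hu : IsMeasurableGLMinimizer p F W Ω u g) (hp : 1 ≤ p) (hlam : 0 < lam)
    (hm : 0 ≤ m) (hF : DirichletGrowth p lam F) (hW : PotentialGrowth m lam W)
    {K : Set (EuclideanSpace ℝ (Fin n))} (hK : IsCompact K) (hKΩ : K ⊆ Ω) : glEnergy F W u g K ≠ ⊤ := by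
  have : IsFiniteMeasure (volume.restrict K) := ⟨by simpa using hK.measure_lt_top⟩
  have h1 : Integrable (fun x => lam * ‖g x‖ ^ p + lam) (volume.restrict K) := by
    have h2 := (hu.hasWeakGradLoc.memLp_grad K hK hKΩ).integrable_norm_rpow
      (by simp; linarith) ENNReal.ofReal_ne_top
    rw [ENNReal.toReal_ofReal (by linarith)] at h2
    exact (h2.const_mul lam).add (integrable_const _)
  refine ne_top_of_le_ne_top h1.lintegral_lt_top.ne (lintegral_mono fun x => ?_)
  refine ENNReal.ofReal_le_ofReal (add_le_add (hF _ _ _ (hu.mem_Icc x)).2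
    ((hW _ _ (hu.mem_Icc x)).2.trans ?_))
  have h3 := hu.mem_Icc x
  have h4 : (u x) ^ 2 ≤ 1 := by nlinarith [h3.1, h3.2]
  exact mul_le_of_le_one_right hlam.le
    (Real.rpow_le_one (by linarith) (by nlinarith [sq_nonneg (u x)]) hm)

/-- Comparison with `max (1 - u) ψ` bounds the Dirichlet energy on the set where `1 - u < ψ`. -/
theorem lintegral_rpow_le (hu : IsMeasurableGLMinimizer p F W Ω u g) (hp : 1 ≤ p) (hlam : 0 < lam)
    (hpm : p ≤ m) (hF : DirichletGrowth p lam F) (hW : PotentialGrowth m lam W) (hΩ : IsOpen Ω)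
    {s : ℝ} (hsΩ : Metric.closedBall 0 s ⊆ Ω) {ψ : EuclideanSpace ℝ (Fin n) → ℝ}
    (hψ : ContDiff ℝ ∞ ψ) (hψs : ∀ x ∉ Metric.ball (0 : EuclideanSpace ℝ (Fin n)) s, ψ x ≤ 0) {k L : ℝ} (hk1 : k ≤ 1)
    (hψk : ∀ x, ψ x ≤ k) (hk0 : 0 ≤ k) (hL0 : 0 ≤ L) (hL : ∀ x, ‖gradient ψ x‖ ≤ k * L) :
    ∫⁻ x in {x | 1 - u x < ψ x}, ENNReal.ofReal (‖g x‖ ^ p)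
      ≤ ENNReal.ofReal (lam ^ 2 * (L ^ p + 2 ^ m) * k ^ p) * volume {x | 1 - u x < ψ x} := by
  set A : Set (EuclideanSpace ℝ (Fin n)) := {x | 1 - u x < ψ x} with hA
  set B : Set (EuclideanSpace ℝ (Fin n)) := Metric.ball 0 s with hB
  have hAm : MeasurableSet A :=
    measurableSet_lt (measurable_const.sub hu.measurable) hψ.continuous.measurable
  have hAB : A ⊆ B := by
    intro x hx
    by_contra hxB
    have h1 := hψs x hxB
    have h2 : 1 - u x < ψ x := hx
    linarith [(hu.mem_Icc x).2]
  have hcB : closure B ⊆ Metric.closedBall 0 s := Metric.closure_ball_subset_closedBall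
  set f : EuclideanSpace ℝ (Fin n) → ℝ := fun x => max (ψ x - (1 - u x)) 0 with hf
  set gf : EuclideanSpace ℝ (Fin n) → EuclideanSpace ℝ (Fin n) := A.indicator fun x => gradient ψ x + g x with hgf
  have hfg : HasWeakGrad volume Ω f gf := hu.hasWeakGrad_posPart hp hΩ hψ
  -- The competitor is `min u (1 - ψ)`; it differs from `u` only on `A`.
  set v : EuclideanSpace ℝ (Fin n) → ℝ := fun x => u x - f x with hv
  set gv : EuclideanSpace ℝ (Fin n) → EuclideanSpace ℝ (Fin n) := fun x => g x - gf x with hgv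
  have hvA : ∀ x ∈ A, v x = 1 - ψ x := by
    intro x hx
    have h2 : 1 - u x < ψ x := hx
    simp only [hv, hf]
    rw [max_eq_left (by linarith)]
    ring
  have hvA' : ∀ x ∉ A, v x = u x := by
    intro x hx
    have h2 : ψ x ≤ 1 - u x := not_lt.1 hx
    simp only [hv, hf]
    rw [max_eq_right (by linarith), sub_zero]
  have hgvA : ∀ x ∈ A, gv x = -gradient ψ x := by
    intro x hx
    simp only [hgv, hgf, indicator_of_mem hx]
    abel
  have hgvA' : ∀ x ∉ A, gv x = g x := by
    intro x hx
    simp only [hgv, hgf, indicator_of_notMem hx, sub_zero]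
  have hψA : ∀ x ∈ A, 0 < ψ x := by
    intro x hx
    have h2 : 1 - u x < ψ x := hx
    linarith [(hu.mem_Icc x).2]
  have hvI : ∀ x, v x ∈ Icc (-1 : ℝ) 1 := by
    intro x
    by_cases hx : x ∈ A
    · rw [hvA x hx]
      constructor <;> linarith [hψA x hx, hψk x]
    · rw [hvA' x hx]
      exact hu.mem_Icc x
  have hvm : Measurable v := hu.measurable.sub
    ((hψ.continuous.measurable.sub (measurable_const.sub hu.measurable)).max measurable_const)
  have hgvm : Measurable gv := hu.measurable_grad.sub
    (((continuous_gradient_of_contDiff hψ).measurable.add hu.measurable_grad).indicator hAm)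
  have hvloc : HasWeakGradLoc p Ω v gv := by
    refine ((hu.hasWeakGradLoc.hasWeakGrad hp hΩ).sub hfg).hasWeakGradLoc ?_ ?_
    · intro K hK hKΩ
      have : IsFiniteMeasure (volume.restrict K) := ⟨by simpa using hK.measure_lt_top⟩
      refine MemLp.of_bound hvm.aestronglyMeasurable 1 (Eventually.of_forall fun x => ?_)
      exact abs_le.2 (hvI x)
    · intro K hK hKΩ
      have : IsFiniteMeasure (volume.restrict K) := ⟨by simpa using hK.measure_lt_top⟩
      have h1 : MemLp (fun x => ‖g x‖ + k * L) (ENNReal.ofReal p) (volume.restrict K) :=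
        (hu.hasWeakGradLoc.memLp_grad K hK hKΩ).norm.add (memLp_const _)
      refine h1.mono hgvm.aestronglyMeasurable (Eventually.of_forall fun x => ?_)
      refine le_trans ?_ (le_abs_self _)
      by_cases hx : x ∈ A
      · rw [show g x - gf x = gv x from rfl, hgvA x hx, norm_neg]
        linarith [hL x, norm_nonneg (g x)]
      · rw [show g x - gf x = gv x from rfl, hgvA' x hx]
        linarith [mul_nonneg hk0 hL0]
  have hmin := hu.energy_le B Metric.isOpen_ball
    ((isCompact_closedBall 0 s).of_isClosed_subset isClosed_closure hcB) (hcB.trans hsΩ) v gv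
    hvloc hvI fun x hx => hvA' x fun hxA => hx (hAB hxA)
  have hsplit : ∀ E : EuclideanSpace ℝ (Fin n) → ℝ≥0∞, ∫⁻ x in B, E x = (∫⁻ x in A, E x) + ∫⁻ x in B \ A, E x := by
    intro E
    rw [← lintegral_add_compl (μ := volume.restrict B) E hAm, Measure.restrict_restrict hAm,
      Measure.restrict_restrict hAm.compl, inter_eq_left.2 hAB, sdiff_eq, inter_comm]
  rw [glEnergy, glEnergy, hsplit, hsplit fun x => ENNReal.ofReal (F (gv x) (v x) x + W (v x) x)]
    at hmin
  have hsame : ∫⁻ x in B \ A, ENNReal.ofReal (F (gv x) (v x) x + W (v x) x)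
      = ∫⁻ x in B \ A, ENNReal.ofReal (F (g x) (u x) x + W (u x) x) := by
    refine setLIntegral_congr_fun (measurableSet_ball.diff hAm) fun x hx => ?_
    simp only [hvA' x hx.2, hgvA' x hx.2]
  have hfin : ∫⁻ x in B \ A, ENNReal.ofReal (F (g x) (u x) x + W (u x) x) ≠ ⊤ := by
    refine ne_top_of_le_ne_top (hu.glEnergy_ne_top hp hlam (by linarith) hF hW
      (isCompact_closedBall 0 s) hsΩ) (lintegral_mono_set ?_)
    exact sdiff_subset.trans Metric.ball_subset_closedBall
  rw [hsame, ENNReal.add_le_add_iff_right hfin] at hmin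
  have hlow : ENNReal.ofReal lam⁻¹ * ∫⁻ x in A, ENNReal.ofReal (‖g x‖ ^ p)
      ≤ ∫⁻ x in A, ENNReal.ofReal (F (g x) (u x) x + W (u x) x) := by
    rw [← lintegral_const_mul' _ _ ENNReal.ofReal_ne_top]
    refine lintegral_mono fun x => ?_
    rw [← ENNReal.ofReal_mul (inv_nonneg.2 hlam.le)]
    refine ENNReal.ofReal_le_ofReal ?_
    have h1 := (hF (g x) (u x) x (hu.mem_Icc x)).1
    have h2 := (hW (u x) x (hu.mem_Icc x)).1
    have h3 : (u x) ^ 2 ≤ 1 := by nlinarith [(hu.mem_Icc x).1, (hu.mem_Icc x).2]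
    have h4 : 0 ≤ lam⁻¹ * (1 - u x ^ 2) ^ m :=
      mul_nonneg (inv_nonneg.2 hlam.le) (Real.rpow_nonneg (by linarith) _)
    linarith
  have hup : ∫⁻ x in A, ENNReal.ofReal (F (gv x) (v x) x + W (v x) x)
      ≤ ENNReal.ofReal (lam * ((L ^ p + 2 ^ m) * k ^ p)) * volume A := by
    rw [← setLIntegral_const]
    refine setLIntegral_mono' hAm fun x hx => ENNReal.ofReal_le_ofReal ?_
    have h1 := (hF (gv x) (v x) x (hvI x)).2
    have h2 := (hW (v x) x (hvI x)).2
    have h3 : ‖gv x‖ ^ p ≤ L ^ p * k ^ p := by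
      rw [hgvA x hx, norm_neg, ← Real.mul_rpow hL0 hk0, mul_comm L k]
      exact Real.rpow_le_rpow (norm_nonneg _) (hL x) (by linarith)
    -- Since `1 - (1 - ψ)² ≤ 2ψ ≤ 2k`, the potential is of order `k^m`. With `k ≤ 1` and `p ≤ m`
    -- this is no worse than the gradient cost `k^p`.
    have h4 : (1 - v x ^ 2) ^ m ≤ 2 ^ m * k ^ p := by
      have h5 := hψA x hx
      have h6 := hψk x
      have hkpos : 0 < k := h5.trans_le h6
      rw [hvA x hx]
      calc (1 - (1 - ψ x) ^ 2) ^ m ≤ (2 * k) ^ m := by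
            refine Real.rpow_le_rpow ?_ ?_ (by linarith) <;> nlinarith
        _ = 2 ^ m * k ^ m := Real.mul_rpow (by norm_num) hk0
        _ ≤ 2 ^ m * k ^ p := by
            gcongr ?_ * ?_
            exact Real.rpow_le_rpow_of_exponent_ge hkpos hk1 hpm
    nlinarith [mul_le_mul_of_nonneg_left h3 hlam.le, mul_le_mul_of_nonneg_left h4 hlam.le]
  calc ∫⁻ x in A, ENNReal.ofReal (‖g x‖ ^ p)
      = ENNReal.ofReal lam * (ENNReal.ofReal lam⁻¹ * ∫⁻ x in A, ENNReal.ofReal (‖g x‖ ^ p)) := by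
        rw [← mul_assoc, ← ENNReal.ofReal_mul hlam.le, mul_inv_cancel₀ hlam.ne',
          ENNReal.ofReal_one, one_mul]
    _ ≤ ENNReal.ofReal lam *
          (ENNReal.ofReal (lam * ((L ^ p + 2 ^ m) * k ^ p)) * volume A) := by
        gcongr ENNReal.ofReal lam * ?_
        exact hlow.trans (hmin.trans hup)
    _ = _ := by
        rw [← mul_assoc, ← ENNReal.ofReal_mul hlam.le]
        congr 2
        ring

end IsMeasurableGLMinimizer

end Minimizers

/-! ### De Giorgi iteration -/

section DeGiorgi

open scoped ContDiff ENNReal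

variable {n : ℕ}

/-- Young's inequality with a small constant. -/
theorem exists_le_mul_rpow_add {p : ℝ} (hp : 1 < p) {ε : ℝ} (hε : 0 < ε) :
    ∃ C : ℝ, 0 < C ∧ ∀ t : ℝ, 0 ≤ t → t ≤ ε * t ^ p + C := by
  -- The constant is the threshold beyond which `ε * t ^ (p - 1) ≥ 1`.
  refine ⟨(ε⁻¹) ^ (p - 1)⁻¹, by positivity, fun t ht => ?_⟩
  rcases le_or_gt t ((ε⁻¹) ^ (p - 1)⁻¹) with h | h
  · have : 0 ≤ ε * t ^ p := by positivity
    linarith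
  · have hC : 0 < (ε⁻¹) ^ (p - 1)⁻¹ := by positivity
    have ht0 : 0 < t := hC.trans h
    have h1 : ε⁻¹ ≤ t ^ (p - 1) := by
      have := Real.rpow_le_rpow hC.le h.le (by linarith : 0 ≤ p - 1)
      rwa [← Real.rpow_mul (by positivity), inv_mul_cancel₀ (by linarith), Real.rpow_one] at this
    have h2 : t ^ p = t ^ (p - 1) * t := by
      rw [← Real.rpow_add_one ht0.ne']
      congr 1
      ring
    have h3 : 1 ≤ ε * t ^ (p - 1) := by
      calc (1 : ℝ) = ε * ε⁻¹ := (mul_inv_cancel₀ hε.ne').symm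
        _ ≤ _ := by gcongr
    have h4 : t ≤ ε * t ^ p := by
      rw [h2]
      nlinarith
    linarith

theorem exists_smooth_cutoff {s' s : ℝ} (hs' : 0 < s') (hs : s' < s) :
    ∃ (η : EuclideanSpace ℝ (Fin n) → ℝ) (L : ℝ), 0 ≤ L ∧ ContDiff ℝ ∞ η ∧ (∀ x, η x ≤ 1) ∧ (∀ x ∈ Metric.closedBall 0 s', η x = 1) ∧
      (∀ x ∉ Metric.ball 0 s, η x = 0) ∧ ∀ x, ‖gradient η x‖ ≤ L := by
  set η : ContDiffBump (0 : EuclideanSpace ℝ (Fin n)) := ⟨s', s, hs', hs⟩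
  have hη : ContDiff ℝ ∞ (η : EuclideanSpace ℝ (Fin n) → ℝ) := η.contDiff
  obtain ⟨L, hL⟩ := (hη.continuous_fderiv (by simp)).bounded_above_of_compact_support
    (η.hasCompactSupport.fderiv ℝ)
  refine ⟨η, L, (norm_nonneg _).trans (hL 0), hη, fun x => η.le_one,
    fun x hx => η.one_of_mem_closedBall hx, fun x hx => ?_, fun x => ?_⟩
  · exact η.zero_of_le_dist (not_lt.1 hx)
  · rw [gradient, LinearIsometryEquiv.norm_map]
    exact hL x

/-- The constant in the energy estimate for minimizers. -/
noncomputable def energyConst (p m lam L : ℝ) : ℝ := lam ^ 2 * (L ^ p + 2 ^ m)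

theorem energyConst_nonneg (p m lam : ℝ) {L : ℝ} (hL : 0 ≤ L) : 0 ≤ energyConst p m lam L := by
  unfold energyConst
  positivity

namespace IsMeasurableGLMinimizer

variable {p m lam : ℝ} {F : EuclideanSpace ℝ (Fin n) → ℝ → EuclideanSpace ℝ (Fin n) → ℝ}
  {W : ℝ → EuclideanSpace ℝ (Fin n) → ℝ} {Ω : Set (EuclideanSpace ℝ (Fin n))}
  {u : EuclideanSpace ℝ (Fin n) → ℝ} {g : EuclideanSpace ℝ (Fin n) → EuclideanSpace ℝ (Fin n)}

/-- Applying the Young-type bound `hY` to `‖g x‖ / k` converts the energy bound of order `k^p` into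
an `L¹` bound of order `k`. The large constant `C` multiplies only the measure of `S`, while the
full sublevel set carries the factor `ε`; this is what makes thin layers measurable from below later
on. -/
theorem lintegral_enorm_le (hu : IsMeasurableGLMinimizer p F W Ω u g) (hp : 1 ≤ p)
    (hlam : 0 < lam) (hpm : p ≤ m) (hF : DirichletGrowth p lam F) (hW : PotentialGrowth m lam W)
    (hΩ : IsOpen Ω) {s : ℝ} (hsΩ : Metric.closedBall 0 s ⊆ Ω)
    {ψ : EuclideanSpace ℝ (Fin n) → ℝ} (hψ : ContDiff ℝ ∞ ψ)
    (hψs : ∀ x ∉ Metric.ball 0 s, ψ x ≤ 0) {k L : ℝ} (hk1 : k ≤ 1)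
    (hψk : ∀ x, ψ x ≤ k) (hk0 : 0 < k) (hL0 : 0 ≤ L) (hL : ∀ x, ‖gradient ψ x‖ ≤ k * L)
    {S : Set (EuclideanSpace ℝ (Fin n))} (hS : S ⊆ {x | 1 - u x < ψ x})
    {ε C : ℝ} (hε : 0 ≤ ε) (hC : 0 ≤ C) (hY : ∀ t : ℝ, 0 ≤ t → t ≤ ε * t ^ p + C) :
    ∫⁻ x in S, ‖g x‖ₑ ≤ ENNReal.ofReal k *
      (ENNReal.ofReal (ε * energyConst p m lam L) * volume {x | 1 - u x < ψ x}
        + ENNReal.ofReal C * volume S) := by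
  have hen := hu.lintegral_rpow_le hp hlam hpm hF hW hΩ hsΩ hψ hψs hk1 hψk hk0.le hL0 hL
  have hkp : 0 < k ^ p := by positivity
  have hpt : ∀ x, ‖g x‖ₑ ≤ ENNReal.ofReal k *
      (ENNReal.ofReal (ε * (k ^ p)⁻¹) * ENNReal.ofReal (‖g x‖ ^ p) + ENNReal.ofReal C) := by
    intro x
    have h1 := hY (‖g x‖ / k) (by positivity)
    rw [Real.div_rpow (norm_nonneg _) hk0.le, div_le_iff₀ hk0] at h1
    rw [← ofReal_norm, ← ENNReal.ofReal_mul (by positivity),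
      ← ENNReal.ofReal_add (by positivity) hC, ← ENNReal.ofReal_mul hk0.le]
    refine ENNReal.ofReal_le_ofReal (h1.trans (le_of_eq ?_))
    rw [div_eq_mul_inv]
    ring
  have hgm : Measurable fun x => ENNReal.ofReal (‖g x‖ ^ p) :=
    (hu.measurable_grad.norm.pow_const p).ennreal_ofReal
  calc ∫⁻ x in S, ‖g x‖ₑ
      ≤ ∫⁻ x in S, ENNReal.ofReal k *
          (ENNReal.ofReal (ε * (k ^ p)⁻¹) * ENNReal.ofReal (‖g x‖ ^ p) + ENNReal.ofReal C) :=
        lintegral_mono hpt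
    _ = ENNReal.ofReal k * (ENNReal.ofReal (ε * (k ^ p)⁻¹) *
          (∫⁻ x in S, ENNReal.ofReal (‖g x‖ ^ p)) + ENNReal.ofReal C * volume S) := by
        rw [lintegral_const_mul' _ _ ENNReal.ofReal_ne_top,
          lintegral_add_right _ measurable_const, lintegral_const_mul' _ _ ENNReal.ofReal_ne_top,
          setLIntegral_const]
    _ ≤ ENNReal.ofReal k * (ENNReal.ofReal (ε * (k ^ p)⁻¹) *
          (ENNReal.ofReal (lam ^ 2 * (L ^ p + 2 ^ m) * k ^ p) * volume {x | 1 - u x < ψ x})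
          + ENNReal.ofReal C * volume S) := by
        gcongr
        exact (lintegral_mono_set hS).trans hen
    _ = _ := by
        rw [← mul_assoc (ENNReal.ofReal (ε * (k ^ p)⁻¹)), ← ENNReal.ofReal_mul (by positivity),
          energyConst]
        congr 4
        field_simp

/-- One step of the De Giorgi iteration. -/
theorem measure_step (hu : IsMeasurableGLMinimizer p F W Ω u g) (hp : 1 ≤ p)
    (hlam : 0 < lam) (hpm : p ≤ m) (hF : DirichletGrowth p lam F) (hW : PotentialGrowth m lam W)
    (hΩ : IsOpen Ω) {s ρ : ℝ} (hρ : 0 < ρ) (hsΩ : Metric.closedBall 0 (s + ρ) ⊆ Ω)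
    {ψ : EuclideanSpace ℝ (Fin n) → ℝ} (hψ : ContDiff ℝ ∞ ψ)
    (hψs : ∀ x ∉ Metric.ball 0 s, ψ x ≤ 0) {k L : ℝ} (hk1 : k ≤ 1)
    (hψk : ∀ x, ψ x ≤ k) (hk0 : 0 < k) (hL0 : 0 ≤ L) (hL : ∀ x, ‖gradient ψ x‖ ≤ k * L)
    (hsmall : volume {x | 1 - u x < ψ x}
      ≤ volume (Metric.ball (0 : EuclideanSpace ℝ (Fin n)) ρ) / 2) {δ : ℝ} (hδ : 0 < δ) :
    ENNReal.ofReal δ * volume {x | 1 - u x < ψ x - δ} ≤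
      ENNReal.ofReal (2 * ρ * k * (L + energyConst p m lam L + 1))
        * volume {x | 1 - u x < ψ x} := by
  set A : Set (EuclideanSpace ℝ (Fin n)) := {x | 1 - u x < ψ x} with hA
  have hAm : MeasurableSet A :=
    measurableSet_lt (measurable_const.sub hu.measurable) hψ.continuous.measurable
  have hE := energyConst_nonneg p m lam hL0
  set f : EuclideanSpace ℝ (Fin n) → ℝ := fun x => max (ψ x - (1 - u x)) 0 with hf
  have hfm : Measurable f :=
    (hψ.continuous.measurable.sub (measurable_const.sub hu.measurable)).max measurable_const
  have hsρ : Metric.closedBall (0 : EuclideanSpace ℝ (Fin n)) s ⊆ Metric.closedBall 0 (s + ρ) :=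
    Metric.closedBall_subset_closedBall (by linarith)
  have hfne : {x | f x ≠ 0} ⊆ A := by
    intro x hx
    by_contra hxA
    have h2 : ψ x ≤ 1 - u x := not_lt.1 hxA
    exact hx (max_eq_right (by linarith))
  have h1 := (hu.hasWeakGrad_posPart hp hΩ hψ).lintegral_enorm_le_of_measure_ne_zero_le hΩ hfm hρ
    hsΩ ((measure_mono hfne).trans hsmall)
  have h2 : ∫⁻ x in Metric.closedBall 0 (s + ρ), ‖A.indicator (fun x => gradient ψ x + g x) x‖ₑ
      ≤ ENNReal.ofReal (k * (L + energyConst p m lam L + 1)) * volume A := by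
    have h3 : ∫⁻ x in A, ‖g x‖ₑ ≤ _ :=
      hu.lintegral_enorm_le hp hlam hpm hF hW hΩ (hsρ.trans hsΩ) hψ hψs hk1 hψk hk0 hL0 hL
        (S := A) subset_rfl zero_le_one zero_le_one fun t ht => by
          rcases le_total t 1 with h | h
          · have : 0 ≤ t ^ p := by positivity
            linarith
          · have : t ^ (1 : ℝ) ≤ t ^ p := Real.rpow_le_rpow_of_exponent_le h hp
            rw [Real.rpow_one] at this
            linarith
    calc ∫⁻ x in Metric.closedBall 0 (s + ρ), ‖A.indicator (fun x => gradient ψ x + g x) x‖ₑ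
        ≤ ∫⁻ x, ‖A.indicator (fun x => gradient ψ x + g x) x‖ₑ := setLIntegral_le_lintegral _ _
      _ = ∫⁻ x in A, ‖gradient ψ x + g x‖ₑ := by
          rw [← lintegral_indicator hAm]
          refine lintegral_congr fun x => ?_
          rw [enorm_indicator_eq_indicator_enorm]
      _ ≤ ∫⁻ x in A, (ENNReal.ofReal (k * L) + ‖g x‖ₑ) := by
          refine lintegral_mono fun x => (enorm_add_le _ _).trans ?_
          gcongr
          rw [← ofReal_norm]
          exact ENNReal.ofReal_le_ofReal (hL x)
      _ = ENNReal.ofReal (k * L) * volume A + ∫⁻ x in A, ‖g x‖ₑ := by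
          rw [lintegral_add_left measurable_const, setLIntegral_const]
      _ ≤ ENNReal.ofReal (k * L) * volume A + ENNReal.ofReal k *
          (ENNReal.ofReal (1 * energyConst p m lam L) * volume A + ENNReal.ofReal 1 * volume A) := by
          gcongr
      _ = _ := by
          rw [← add_mul, ← ENNReal.ofReal_add (by positivity) zero_le_one, ← mul_assoc,
            ← ENNReal.ofReal_mul hk0.le, ← add_mul,
            ← ENNReal.ofReal_add (by positivity) (by positivity)]
          congr 2
          ring
  set A' : Set (EuclideanSpace ℝ (Fin n)) := {x | 1 - u x < ψ x - δ} with hA'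
  have hA'm : MeasurableSet A' :=
    measurableSet_lt (measurable_const.sub hu.measurable)
      (hψ.continuous.measurable.sub measurable_const)
  have hA's : A' ⊆ Metric.ball 0 s := by
    intro x hx
    by_contra hxs
    have h4 : 1 - u x < ψ x - δ := hx
    linarith [hψs x hxs, (hu.mem_Icc x).2]
  -- Chebyshev's inequality: `f ≥ δ` on `A'`.
  calc ENNReal.ofReal δ * volume A' = ∫⁻ _ in A', ENNReal.ofReal δ := (setLIntegral_const _ _).symm
    _ ≤ ∫⁻ x in A', ‖f x‖ₑ := by
        refine setLIntegral_mono' hA'm fun x hx => ?_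
        rw [← ofReal_norm]
        refine ENNReal.ofReal_le_ofReal (le_trans ?_ (le_abs_self _))
        have h4 : 1 - u x < ψ x - δ := hx
        exact le_trans (by linarith) (le_max_left _ _)
    _ ≤ ∫⁻ x in Metric.ball 0 s, ‖f x‖ₑ := lintegral_mono_set hA's
    _ ≤ 2 * (ENNReal.ofReal ρ *
          (ENNReal.ofReal (k * (L + energyConst p m lam L + 1)) * volume A)) := by
        refine h1.trans ?_
        gcongr
    _ = _ := by
        have htwo : ∀ X : ℝ≥0∞, 2 * X = ENNReal.ofReal 2 * X := by simp
        rw [htwo, ← mul_assoc, ← mul_assoc,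
          ← ENNReal.ofReal_mul zero_le_two, ← ENNReal.ofReal_mul (by positivity)]
        congr 2
        ring

end IsMeasurableGLMinimizer

theorem volume_ball_div_two (ρ : ℝ) :
    volume (Metric.ball (0 : EuclideanSpace ℝ (Fin n)) (ρ / 2))
      = ENNReal.ofReal ((1 / 2) ^ n) * volume (Metric.ball (0 : EuclideanSpace ℝ (Fin n)) ρ) := by
  have h := Measure.addHaar_ball_mul_of_pos (volume : Measure (EuclideanSpace ℝ (Fin n))) 0
    (by norm_num : (0 : ℝ) < 1 / 2) ρ
  rw [finrank_euclideanSpace_fin] at h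
  rw [← h]
  congr 2
  ring

/-- De Giorgi's lemma: if `1 - u < k` only on a small part of `B_s` then `1 - u ≥ k / 2` almost
everywhere in `B_{s'}`. -/
theorem exists_forall_le_of_measure_lt_le (hn : n ≠ 0) {p m lam : ℝ} (hp : 1 ≤ p) (hlam : 0 < lam)
    (hpm : p ≤ m) {s' s t : ℝ} (hs' : 0 < s') (hs : s' < s) (ht : s < t) :
    ∃ ν : ℝ, 0 < ν ∧ ∀ (F : EuclideanSpace ℝ (Fin n) → ℝ → EuclideanSpace ℝ (Fin n) → ℝ)
      (W : ℝ → EuclideanSpace ℝ (Fin n) → ℝ) (Ω : Set (EuclideanSpace ℝ (Fin n)))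
      (u : EuclideanSpace ℝ (Fin n) → ℝ) (g : EuclideanSpace ℝ (Fin n) → EuclideanSpace ℝ (Fin n)),
      IsMeasurableGLMinimizer p F W Ω u g → DirichletGrowth p lam F → PotentialGrowth m lam W →
      IsOpen Ω → Metric.closedBall 0 t ⊆ Ω → ∀ k : ℝ, 0 < k → k ≤ 1 →
      volume (Metric.ball 0 s ∩ {x | 1 - u x < k}) ≤ ENNReal.ofReal ν →
      volume (Metric.ball 0 s' ∩ {x | 1 - u x < k / 2}) = 0 := by
  obtain ⟨η, L, hL0, hη, hη1, hηs', hηs, hηL⟩ := exists_smooth_cutoff (n := n) hs' hs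
  set C := L + energyConst p m lam L + 1 with hC
  have hC0 : 0 < C := by linarith [energyConst_nonneg p m lam hL0]
  -- The first bound keeps the translated balls inside `B_t`; the second makes the factor `8 * ρ₀ *
  -- C` of the recursion at most `2^{-n}`.
  set ρ₀ := min (t - s) ((1 / 2) ^ n / (8 * C)) with hρ₀def
  have hρ₀ : 0 < ρ₀ := lt_min (by linarith) (by positivity)
  have hρ₀t : ρ₀ ≤ t - s := min_le_left _ _
  have hρ₀C : 8 * ρ₀ * C ≤ (1 / 2) ^ n := by
    have : ρ₀ ≤ (1 / 2) ^ n / (8 * C) := min_le_right _ _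
    rw [le_div_iff₀ (by positivity)] at this
    linarith
  set ν := (volume (Metric.ball (0 : EuclideanSpace ℝ (Fin n)) ρ₀) / 2).toReal with hν
  have hνt : volume (Metric.ball (0 : EuclideanSpace ℝ (Fin n)) ρ₀) / 2 ≠ ⊤ :=
    ENNReal.div_ne_top measure_ball_lt_top.ne (by simp)
  refine ⟨ν, ENNReal.toReal_pos
    (ENNReal.div_pos (Metric.measure_ball_pos volume 0 hρ₀).ne' (by simp)).ne' hνt, ?_⟩
  intro F W Ω u g hu hF hW hΩ htΩ k hk0 hk1 hk
  rw [hν, ENNReal.ofReal_toReal hνt] at hk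
  -- The obstacles descend from `k * η` towards `k * η - k / 2`, and consecutive ones differ by `k /
  -- 4 * (1 / 2) ^ j`. On `B_{s'}`, where `η = 1`, all of them exceed `k / 2`.
  set ψ : ℕ → EuclideanSpace ℝ (Fin n) → ℝ :=
    fun j x => k * η x - k / 2 * (1 - (1 / 2) ^ j) with hψ
  have hpow : ∀ j : ℕ, (1 / 2 : ℝ) ^ j ≤ 1 := fun j => pow_le_one₀ (by norm_num) (by norm_num)
  have hψc : ∀ j, ContDiff ℝ ∞ (ψ j) := fun j => (contDiff_const.mul hη).sub contDiff_const
  have hψs : ∀ j, ∀ x ∉ Metric.ball 0 s, ψ j x ≤ 0 := by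
    intro j x hx
    simp only [hψ, hηs x hx]
    nlinarith [hpow j]
  have hψk : ∀ j x, ψ j x ≤ k := by
    intro j x
    simp only [hψ]
    nlinarith [hpow j, hη1 x]
  have hψL : ∀ j x, ‖gradient (ψ j) x‖ ≤ k * L := by
    intro j x
    have h1 : fderiv ℝ (ψ j) x = k • fderiv ℝ η x := by
      simp only [hψ]
      rw [fderiv_sub_const, fderiv_const_mul (hη.differentiable (by simp) x)]
    rw [gradient, LinearIsometryEquiv.norm_map, h1, norm_smul, Real.norm_of_nonneg hk0.le]
    have := hηL x
    rw [gradient, LinearIsometryEquiv.norm_map] at this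
    gcongr
  set ρ : ℕ → ℝ := fun j => ρ₀ * (1 / 2) ^ j with hρ
  have hρ0 : ∀ j, 0 < ρ j := fun j => by positivity
  -- The translation radius shrinks together with the sublevel set: its measure stays below half of
  -- a ball of radius `ρ j`. A linear recursion then suffices, without a superlinear gain.
  have hind : ∀ j, volume {x | 1 - u x < ψ j x}
      ≤ volume (Metric.ball (0 : EuclideanSpace ℝ (Fin n)) (ρ j)) / 2 := by
    intro j
    induction j with
    | zero =>
      have e1 : ρ 0 = ρ₀ := by simp [hρ]
      rw [e1]
      refine (measure_mono ?_).trans hk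
      intro x hx
      have h1 : 1 - u x < ψ 0 x := hx
      refine ⟨?_, h1.trans_le (hψk 0 x)⟩
      by_contra hxs
      linarith [hψs 0 x hxs, (hu.mem_Icc x).2]
    | succ j ih =>
      have hstep := hu.measure_step hp hlam hpm hF hW hΩ (hρ0 j) (s := s)
        ((Metric.closedBall_subset_closedBall (by
          have : ρ j ≤ ρ₀ := mul_le_of_le_one_right hρ₀.le (hpow j)
          linarith)).trans htΩ) (hψc j) (hψs j) hk1 (hψk j) hk0 hL0 (hψL j) ih
        (δ := k / 4 * (1 / 2) ^ j) (by positivity)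
      have e1 : ∀ x, ψ j x - k / 4 * (1 / 2) ^ j = ψ (j + 1) x := by
        intro x
        simp only [hψ, pow_succ]
        ring
      simp only [e1] at hstep
      -- The powers of `1 / 2` in `ρ j` and in the level gap cancel, leaving the factor `8 * ρ₀ *
      -- C`. It is at most `2^{-n}`, the volume ratio of the balls of radii `ρ (j + 1)` and `ρ j`,
      -- which closes the induction.
      have e2 : 2 * ρ j * k * (L + energyConst p m lam L + 1)
          ≤ k / 4 * (1 / 2) ^ j * (1 / 2) ^ n := by
        rw [← hC]
        have : 2 * ρ j * k * C = k / 4 * (1 / 2) ^ j * (8 * ρ₀ * C) := by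
          simp only [hρ]; ring
        rw [this]
        gcongr
      have h3 : ENNReal.ofReal (k / 4 * (1 / 2) ^ j) * volume {x | 1 - u x < ψ (j + 1) x}
          ≤ ENNReal.ofReal (k / 4 * (1 / 2) ^ j) *
            (ENNReal.ofReal ((1 / 2) ^ n) * volume {x | 1 - u x < ψ j x}) := by
        rw [← mul_assoc (ENNReal.ofReal (k / 4 * (1 / 2) ^ j)),
          ← ENNReal.ofReal_mul (by positivity)]
        exact hstep.trans (mul_le_mul' (ENNReal.ofReal_le_ofReal e2) le_rfl)
      have h4 := (ENNReal.mul_le_mul_iff_right (by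
        simpa using (by positivity : 0 < k / 4 * (1 / 2) ^ j)) ENNReal.ofReal_ne_top).1 h3
      have e3 : ρ (j + 1) = ρ j / 2 := by
        simp only [hρ, pow_succ]; ring
      rw [e3, volume_ball_div_two (ρ j), mul_div_assoc]
      exact h4.trans (by gcongr)
  have hle : ∀ j : ℕ, volume (Metric.ball 0 s' ∩ {x | 1 - u x < k / 2})
      ≤ volume (Metric.ball (0 : EuclideanSpace ℝ (Fin n)) (ρ j)) := by
    intro j
    refine (measure_mono ?_).trans ((hind j).trans ENNReal.half_le_self)
    rintro x ⟨hx, hxk⟩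
    have h1 : 1 - u x < k / 2 := hxk
    simp only [hψ, mem_ofPred_eq, hηs' x (Metric.ball_subset_closedBall hx)]
    have : 0 < k / 2 * (1 / 2) ^ j := by positivity
    linarith
  have hlim : Tendsto (fun j => volume (Metric.ball (0 : EuclideanSpace ℝ (Fin n)) (ρ j))) atTop
      (𝓝 0) := by
    have h1 : Tendsto ρ atTop (𝓝 0) := by
      have h := (tendsto_pow_atTop_nhds_zero_of_lt_one (r := (1 / 2 : ℝ))
        (by norm_num) (by norm_num)).const_mul ρ₀
      rwa [mul_zero] at h
    have h2 : Tendsto (fun j => ENNReal.ofReal (ρ j ^ n)) atTop (𝓝 0) := by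
      have := ENNReal.tendsto_ofReal (h1.pow n)
      rwa [zero_pow hn, ENNReal.ofReal_zero] at this
    have h3 := ENNReal.Tendsto.mul_const (b := volume (Metric.ball (0 : EuclideanSpace ℝ (Fin n)) 1))
      h2 (Or.inr measure_ball_lt_top.ne)
    rw [zero_mul] at h3
    refine h3.congr fun j => ?_
    rw [Measure.addHaar_ball_of_pos _ _ (hρ0 j), finrank_euclideanSpace_fin]
  exact le_antisymm (ge_of_tendsto' hlim hle) zero_le

end DeGiorgi

/-! ### Smallness of sublevel sets -/

section Density

open scoped ContDiff ENNReal

variable {n : ℕ}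

/-- Isoperimetric estimate between the level sets `{1 - u < k / 2}` and `{1 - u ≥ k}`. -/
theorem IsMeasurableGLMinimizer.measure_mul_measure_le {p m lam : ℝ}
    {F : EuclideanSpace ℝ (Fin n) → ℝ → EuclideanSpace ℝ (Fin n) → ℝ}
    {W : ℝ → EuclideanSpace ℝ (Fin n) → ℝ} {Ω : Set (EuclideanSpace ℝ (Fin n))}
    {u : EuclideanSpace ℝ (Fin n) → ℝ} {g : EuclideanSpace ℝ (Fin n) → EuclideanSpace ℝ (Fin n)}
    (hu : IsMeasurableGLMinimizer p F W Ω u g) (hp : 1 ≤ p)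
    (hlam : 0 < lam) (hpm : p ≤ m) (hF : DirichletGrowth p lam F) (hW : PotentialGrowth m lam W)
    (hΩ : IsOpen Ω) {r : ℝ} (hr : 0 < r) (hrΩ : Metric.closedBall 0 (4 * r) ⊆ Ω)
    {η : EuclideanSpace ℝ (Fin n) → ℝ} {L : ℝ} (hL0 : 0 ≤ L) (hη : ContDiff ℝ ∞ η)
    (hη1 : ∀ x, η x ≤ 1) (hηr : ∀ x ∈ Metric.closedBall 0 (3 * r), η x = 1)
    (hηs : ∀ x ∉ Metric.ball 0 (4 * r), η x = 0) (hηL : ∀ x, ‖gradient η x‖ ≤ L)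
    {k : ℝ} (hk0 : 0 < k) (hk1 : k ≤ 1)
    {ε C : ℝ} (hε : 0 ≤ ε) (hC : 0 ≤ C) (hY : ∀ t : ℝ, 0 ≤ t → t ≤ ε * t ^ p + C) :
    ENNReal.ofReal (1 / 2) * volume (Metric.ball 0 r ∩ {x | 1 - u x < k / 2}) *
        volume (Metric.ball 0 r ∩ {x | k ≤ 1 - u x}) ≤
      volume (Metric.ball (0 : EuclideanSpace ℝ (Fin n)) (2 * r)) * (ENNReal.ofReal (2 * r) *
        (ENNReal.ofReal (ε * energyConst p m lam L) *
            volume (Metric.ball (0 : EuclideanSpace ℝ (Fin n)) (4 * r))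
          + ENNReal.ofReal C *
            volume (Metric.closedBall 0 (3 * r) ∩ {x | k / 2 ≤ 1 - u x ∧ 1 - u x < k}))) := by
  have hwm : Measurable fun x => 1 - u x := measurable_const.sub hu.measurable
  set S : Set (EuclideanSpace ℝ (Fin n)) :=
    Metric.closedBall 0 (3 * r) ∩ {x | k / 2 ≤ 1 - u x ∧ 1 - u x < k} with hS
  have hSm : MeasurableSet S := Metric.isClosed_closedBall.measurableSet.inter
    ((measurableSet_le measurable_const hwm).inter (measurableSet_lt hwm measurable_const))
  -- The truncation equals `k / 2` where `1 - u < k / 2` and `0` where `1 - u ≥ k`; its gradient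
  -- lives on the layer in between.
  set f : EuclideanSpace ℝ (Fin n) → ℝ :=
    fun x => max (k - (1 - u x)) 0 - max (k / 2 - (1 - u x)) 0 with hf
  have hfm : Measurable f := ((measurable_const.sub hwm).max measurable_const).sub
    ((measurable_const.sub hwm).max measurable_const)
  have hfg := (hu.hasWeakGrad_posPart hp hΩ (ψ := fun _ => k) contDiff_const).sub
    (hu.hasWeakGrad_posPart hp hΩ (ψ := fun _ => k / 2) contDiff_const)
  set G : EuclideanSpace ℝ (Fin n) → EuclideanSpace ℝ (Fin n) := fun x =>
    {x | 1 - u x < k}.indicator (fun x => gradient (fun _ => k) x + g x) x -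
    {x | 1 - u x < k / 2}.indicator (fun x => gradient (fun _ => k / 2) x + g x) x with hG
  have hGS : ∀ x ∈ Metric.closedBall 0 (3 * r), ‖G x‖ₑ = S.indicator (fun x => ‖g x‖ₑ) x := by
    intro x hx
    have e1 : ∀ c : ℝ, gradient (fun _ : EuclideanSpace ℝ (Fin n) => c) x = 0 := by
      intro c
      simp [gradient]
    by_cases h1 : 1 - u x < k
    · by_cases h2 : 1 - u x < k / 2
      · have h3 : x ∉ S := fun h => (not_lt.2 h.2.1) h2
        rw [indicator_of_notMem h3]
        simp only [hG]
        rw [indicator_of_mem (by exact h1), indicator_of_mem (by exact h2), e1, e1, sub_self,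
          enorm_zero]
      · have h3 : x ∈ S := ⟨hx, not_lt.1 h2, h1⟩
        rw [indicator_of_mem h3]
        simp only [hG]
        rw [indicator_of_mem (by exact h1), indicator_of_notMem (by exact h2), e1, zero_add,
          sub_zero]
    · have h2 : ¬ 1 - u x < k / 2 := fun h => h1 (by linarith)
      have h3 : x ∉ S := fun h => h1 h.2.2
      rw [indicator_of_notMem h3]
      simp only [hG]
      rw [indicator_of_notMem (by exact h1), indicator_of_notMem (by exact h2), sub_self,
        enorm_zero]
  have hGint : ∫⁻ x in Metric.closedBall 0 (3 * r), ‖G x‖ₑ ≤ ∫⁻ x in S, ‖g x‖ₑ := by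
    rw [← lintegral_indicator hSm,
      setLIntegral_congr_fun Metric.isClosed_closedBall.measurableSet hGS]
    exact setLIntegral_le_lintegral _ _
  have hψL : ∀ x, ‖gradient (fun x => k * η x) x‖ ≤ k * L := by
    intro x
    have h1 : fderiv ℝ (fun x => k * η x) x = k • fderiv ℝ η x :=
      fderiv_const_mul (hη.differentiable (by simp) x) k
    rw [gradient, LinearIsometryEquiv.norm_map, h1, norm_smul, Real.norm_of_nonneg hk0.le]
    have := hηL x
    rw [gradient, LinearIsometryEquiv.norm_map] at this
    gcongr
  have hψs : ∀ x ∉ Metric.ball 0 (4 * r), k * η x ≤ 0 := by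
    intro x hx
    rw [hηs x hx, mul_zero]
  have hgS := hu.lintegral_enorm_le hp hlam hpm hF hW hΩ hrΩ (contDiff_const.mul hη) hψs hk1
    (fun x => mul_le_of_le_one_right hk0.le (hη1 x)) hk0 hL0 hψL (S := S)
    (fun x hx => by
      have h1 := hηr x hx.1
      have h2 := hx.2.2
      simpa [h1] using h2) hε hC hY
  have hA : volume {x | 1 - u x < k * η x}
      ≤ volume (Metric.ball (0 : EuclideanSpace ℝ (Fin n)) (4 * r)) := by
    refine measure_mono fun x hx => ?_
    by_contra hxs
    have h1 : 1 - u x < k * η x := hx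
    linarith [hψs x hxs, (hu.mem_Icc x).2]
  have e3 : r + 2 * r = 3 * r := by ring
  have hiso := hfg.ofReal_mul_measure_mul_measure_le hΩ hfm (c := 0) (r := r) (ρ := 2 * r) le_rfl
    (by rw [e3]; exact (Metric.closedBall_subset_closedBall (by linarith)).trans hrΩ)
    (A := Metric.ball 0 r ∩ {x | 1 - u x < k / 2}) (B := Metric.ball 0 r ∩ {x | k ≤ 1 - u x})
    (measurableSet_ball.inter (measurableSet_lt hwm measurable_const))
    (measurableSet_ball.inter (measurableSet_le measurable_const hwm))
    inter_subset_left inter_subset_left (t := k / 2) (by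
      rintro x ⟨-, hx⟩ y ⟨-, hy⟩
      have hx' : 1 - u x < k / 2 := hx
      have hy' : k ≤ 1 - u y := hy
      rw [max_eq_right (by linarith : k - (1 - u y) ≤ 0),
        max_eq_right (by linarith : k / 2 - (1 - u y) ≤ 0),
        max_eq_left (by linarith : 0 ≤ k - (1 - u x)),
        max_eq_left (by linarith : 0 ≤ k / 2 - (1 - u x)), abs_sub_comm]
      refine le_trans (le_of_eq ?_) (le_abs_self _)
      ring)
  rw [e3] at hiso
  -- Jump and gradient are both proportional to `k`. Cancelling it gives an estimate that is uniform
  -- in the level.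
  have hk : ENNReal.ofReal k ≠ 0 := by simpa using hk0
  refine (ENNReal.mul_le_mul_iff_right hk ENNReal.ofReal_ne_top).1 ?_
  calc ENNReal.ofReal k * (ENNReal.ofReal (1 / 2) *
          volume (Metric.ball 0 r ∩ {x | 1 - u x < k / 2}) *
          volume (Metric.ball 0 r ∩ {x | k ≤ 1 - u x}))
      = ENNReal.ofReal (k / 2) * volume (Metric.ball 0 r ∩ {x | 1 - u x < k / 2}) *
          volume (Metric.ball 0 r ∩ {x | k ≤ 1 - u x}) := by
        rw [← mul_assoc, ← mul_assoc, ← ENNReal.ofReal_mul hk0.le]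
        congr 4
        ring
    _ ≤ volume (Metric.ball (0 : EuclideanSpace ℝ (Fin n)) (2 * r)) * (ENNReal.ofReal (2 * r) *
          (ENNReal.ofReal k * (ENNReal.ofReal (ε * energyConst p m lam L) *
            volume (Metric.ball (0 : EuclideanSpace ℝ (Fin n)) (4 * r))
          + ENNReal.ofReal C * volume S))) := by
        refine hiso.trans ?_
        gcongr
        refine hGint.trans (hgS.trans ?_)
        gcongr
    _ = _ := by ring

/-- If `1 - u ≥ 1` on a fixed part of `B_r` then small sublevel sets of `1 - u` have small
measure. -/
theorem exists_measure_sublevel_le {p m lam : ℝ} (hp : 1 < p) (hlam : 0 < lam)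
    (hpm : p ≤ m) {r α ν : ℝ} (hr : 0 < r) (hα : 0 < α) (hν : 0 < ν) :
    ∃ k : ℝ, 0 < k ∧ k ≤ 1 ∧
      ∀ (F : EuclideanSpace ℝ (Fin n) → ℝ → EuclideanSpace ℝ (Fin n) → ℝ)
      (W : ℝ → EuclideanSpace ℝ (Fin n) → ℝ) (Ω : Set (EuclideanSpace ℝ (Fin n)))
      (u : EuclideanSpace ℝ (Fin n) → ℝ) (g : EuclideanSpace ℝ (Fin n) → EuclideanSpace ℝ (Fin n)),
      IsMeasurableGLMinimizer p F W Ω u g → DirichletGrowth p lam F → PotentialGrowth m lam W →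
      IsOpen Ω → Metric.closedBall 0 (4 * r) ⊆ Ω →
      ENNReal.ofReal α ≤ volume (Metric.ball 0 r ∩ {x | 1 ≤ 1 - u x}) →
      volume (Metric.ball 0 r ∩ {x | 1 - u x < k}) ≤ ENNReal.ofReal ν := by
  obtain ⟨η, L, hL0, hη, hη1, hηr, hηs, hηL⟩ :=
    exists_smooth_cutoff (n := n) (by positivity : 0 < 3 * r) (by linarith : 3 * r < 4 * r)
  have hE := energyConst_nonneg p m lam hL0
  set V := volume.real (Metric.ball (0 : EuclideanSpace ℝ (Fin n)) (4 * r)) with hV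
  have hV0 : 0 ≤ V := measureReal_nonneg
  set M := volume.real (Metric.ball (0 : EuclideanSpace ℝ (Fin n)) (2 * r)) * (2 * r) with hM
  have hM0 : 0 < M := mul_pos (ENNReal.toReal_pos
    (Metric.measure_ball_pos volume 0 (by positivity)).ne' measure_ball_lt_top.ne) (by positivity)
  -- The isoperimetric estimate bounds `α * ν / 2` from above by two terms. This `ε` makes the
  -- energy term at most `α * ν / 4`, so the layer term is at least `α * ν / 4` and each layer has
  -- measure at least `δ`.
  set ε := α * ν / (4 * M * (energyConst p m lam L * V + 1)) with hε
  have hε0 : 0 < ε := by positivity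
  obtain ⟨C, hC0, hY⟩ := exists_le_mul_rpow_add hp hε0
  set δ := α * ν / (4 * M * C) with hδ
  have hδ0 : 0 < δ := by positivity
  -- More than `V / δ` disjoint layers of measure at least `δ` cannot fit in a ball of volume `V`.
  obtain ⟨J, hJ⟩ := exists_nat_gt (V / δ)
  refine ⟨(1 / 2) ^ J, by positivity, pow_le_one₀ (by norm_num) (by norm_num), ?_⟩
  intro F W Ω u g hu hF hW hΩ hrΩ hαu
  by_contra! hbig
  have hwm : Measurable fun x => 1 - u x := measurable_const.sub hu.measurable
  set S : ℕ → Set (EuclideanSpace ℝ (Fin n)) := fun j => Metric.closedBall 0 (3 * r) ∩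
    {x | (1 / 2 : ℝ) ^ j / 2 ≤ 1 - u x ∧ 1 - u x < (1 / 2) ^ j} with hS
  have hSm : ∀ j, MeasurableSet (S j) := fun j => Metric.isClosed_closedBall.measurableSet.inter
    ((measurableSet_le measurable_const hwm).inter (measurableSet_lt hwm measurable_const))
  have hSb : ∀ j, S j ⊆ Metric.ball 0 (4 * r) := fun j =>
    inter_subset_left.trans (Metric.closedBall_subset_ball (by linarith))
  have hfin : ∀ {T : Set (EuclideanSpace ℝ (Fin n))} {R : ℝ}, T ⊆ Metric.ball 0 R →
      volume T ≠ ⊤ := fun hT => (measure_mono hT |>.trans_lt measure_ball_lt_top).ne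
  have hSδ : ∀ j ∈ Finset.range J, δ ≤ volume.real (S j) := by
    intro j hj
    have hjJ : j + 1 ≤ J := Finset.mem_range.1 hj
    have hpj : (0 : ℝ) < (1 / 2) ^ j := by positivity
    have hpj1 : (1 / 2 : ℝ) ^ j ≤ 1 := pow_le_one₀ (by norm_num) (by norm_num)
    have h1 := hu.measure_mul_measure_le hp.le hlam hpm hF hW hΩ hr hrΩ hL0 hη hη1 hηr hηs hηL
      hpj hpj1 hε0.le hC0.le hY
    have h2 : ENNReal.ofReal ν ≤ volume (Metric.ball 0 r ∩ {x | 1 - u x < (1 / 2) ^ j / 2}) := by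
      refine hbig.le.trans (measure_mono ?_)
      rintro x ⟨hx, hxJ⟩
      have hxJ' : 1 - u x < (1 / 2) ^ J := hxJ
      refine ⟨hx, ?_⟩
      have : (1 / 2 : ℝ) ^ J ≤ (1 / 2) ^ (j + 1) :=
        pow_le_pow_of_le_one (by norm_num) (by norm_num) hjJ
      rw [pow_succ] at this
      rw [mem_ofPred_eq]
      linarith
    have h3 : ENNReal.ofReal α ≤ volume (Metric.ball 0 r ∩ {x | (1 / 2) ^ j ≤ 1 - u x}) := by
      refine hαu.trans (measure_mono ?_)
      rintro x ⟨hx, hx1⟩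
      exact ⟨hx, hpj1.trans hx1⟩
    have h4 : ENNReal.ofReal (1 / 2 * ν * α)
        ≤ ENNReal.ofReal (M * (ε * energyConst p m lam L * V + C * volume.real (S j))) := by
      have e : volume (Metric.ball (0 : EuclideanSpace ℝ (Fin n)) (2 * r)) * (ENNReal.ofReal (2 * r) *
          (ENNReal.ofReal (ε * energyConst p m lam L) *
            volume (Metric.ball (0 : EuclideanSpace ℝ (Fin n)) (4 * r))
          + ENNReal.ofReal C * volume (S j)))
          = ENNReal.ofReal (M * (ε * energyConst p m lam L * V + C * volume.real (S j))) := by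
        rw [← ofReal_measureReal (hfin (hSb j)),
          ← ofReal_measureReal (s := Metric.ball (0 : EuclideanSpace ℝ (Fin n)) (2 * r))
            measure_ball_lt_top.ne,
          ← ofReal_measureReal (s := Metric.ball (0 : EuclideanSpace ℝ (Fin n)) (4 * r))
            measure_ball_lt_top.ne, ← ENNReal.ofReal_mul (by positivity),
          ← ENNReal.ofReal_mul hC0.le, ← ENNReal.ofReal_add (by positivity) (by positivity),
          ← mul_assoc, ← ENNReal.ofReal_mul measureReal_nonneg, ← ENNReal.ofReal_mul hM0.le]
      rw [ENNReal.ofReal_mul (by positivity), ENNReal.ofReal_mul (by positivity), ← e]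
      refine le_trans ?_ h1
      gcongr
    rw [ENNReal.ofReal_le_ofReal_iff (by positivity)] at h4
    have h5 : M * (ε * energyConst p m lam L * V) ≤ α * ν / 4 := by
      have h6 : ε * (4 * M * (energyConst p m lam L * V + 1)) = α * ν := by
        rw [hε]
        field_simp
      nlinarith [mul_pos hε0 hM0]
    rw [hδ, div_le_iff₀ (by positivity)]
    nlinarith
  have hdisj : Set.PairwiseDisjoint (Finset.range J : Set ℕ) S := by
    have hlt : ∀ i j : ℕ, i < j → Disjoint (S i) (S j) := by
      intro i j hij
      rw [Set.disjoint_left]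
      rintro x ⟨-, hx1, -⟩ ⟨-, -, hx2⟩
      have : (1 / 2 : ℝ) ^ j ≤ (1 / 2) ^ (i + 1) :=
        pow_le_pow_of_le_one (by norm_num) (by norm_num) hij
      rw [pow_succ] at this
      linarith
    intro i _ j _ hij
    rcases lt_or_gt_of_ne hij with h | h
    · exact hlt i j h
    · exact (hlt j i h).symm
  have hsum : ∑ j ∈ Finset.range J, volume.real (S j) ≤ V := by
    rw [← measureReal_biUnion_finset hdisj (fun j _ => hSm j) (fun j _ => hfin (hSb j))]
    exact measureReal_mono (iUnion₂_subset fun j _ => hSb j) measure_ball_lt_top.ne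
  have hsum' := Finset.sum_le_sum hSδ
  rw [Finset.sum_const, Finset.card_range, nsmul_eq_mul] at hsum'
  rw [div_lt_iff₀ hδ0] at hJ
  linarith

theorem nhds_inf_ae_neBot (x : EuclideanSpace ℝ (Fin n)) :
    (𝓝 x ⊓ ae (volume : Measure (EuclideanSpace ℝ (Fin n)))).NeBot := by
  rw [Filter.inf_neBot_iff]
  intro s hs t ht
  by_contra hst
  have hsub : s ⊆ tᶜ := fun y hy hyt => hst ⟨y, hy, hyt⟩
  exact (Measure.measure_pos_of_mem_nhds volume hs).ne'
    (measure_mono_null hsub (mem_ae_iff.1 ht))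

/-- The lower bound `a` supplies the coboundedness without which a real-valued `limsup` need not be
controlled by upper bounds. -/
theorem essValue_le_of_ae_ball {u : EuclideanSpace ℝ (Fin n) → ℝ} {s a b : ℝ} (hs : 0 < s)
    (h : ∀ᵐ x ∂(volume.restrict (Metric.ball 0 s)), a ≤ u x ∧ u x ≤ b) : essValue u 0 ≤ b := by
  have := nhds_inf_ae_neBot (0 : EuclideanSpace ℝ (Fin n))
  have hev : ∀ᶠ x in 𝓝 (0 : EuclideanSpace ℝ (Fin n)) ⊓ ae volume, a ≤ u x ∧ u x ≤ b := by
    rw [ae_restrict_iff' measurableSet_ball] at h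
    have h1 : ∀ᶠ x in 𝓝 (0 : EuclideanSpace ℝ (Fin n)) ⊓ ae volume, x ∈ Metric.ball 0 s :=
      Filter.Eventually.filter_mono inf_le_left (Metric.ball_mem_nhds 0 hs)
    filter_upwards [h1, Filter.Eventually.filter_mono inf_le_right h] with x hx hx'
    exact hx' hx
  have hbdd : IsBoundedUnder (· ≥ ·) (𝓝 (0 : EuclideanSpace ℝ (Fin n)) ⊓ ae volume) u :=
    ⟨a, by rw [eventually_map]; exact hev.mono fun x hx => hx.1⟩
  exact limsup_le_of_le hbdd.isCoboundedUnder_le (hev.mono fun x hx => hx.2)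

end Density

/-! ### The density estimate -/

theorem lemma2p3 (n : ℕ) (hn : 1 ≤ n) (p m lam : ℝ) (hp : 1 < p)
    (hpn : p * ((n : ℝ) - 1) < (n : ℝ)) (hm : p < m) (hlam : 0 < lam) :
    ∃ σ : ℝ, 0 < σ ∧ ∃ h : ℝ → ℝ, (∀ R : ℝ, 1 ≤ R → 0 < h R) ∧
      ∀ (F : EuclideanSpace ℝ (Fin n) → ℝ → EuclideanSpace ℝ (Fin n) → ℝ)
        (W : ℝ → EuclideanSpace ℝ (Fin n) → ℝ),
        DirichletGrowth p lam F → PotentialGrowth m lam W → PotentialMonotone W →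
        ∀ R : ℝ, 1 ≤ R →
        ∀ Ω : Set (EuclideanSpace ℝ (Fin n)), IsOpen Ω → Metric.ball 0 R ⊆ Ω →
        ∀ u : EuclideanSpace ℝ (Fin n) → ℝ, IsGLMinimizer p F W Ω u →
          1 - h R ≤ essValue u 0 →
          ENNReal.ofReal (σ * R ^ n) ≤ volume (Metric.ball 0 R ∩ {x | 0 ≤ u x}) := by
  have hn0 : n ≠ 0 := by omega
  have hB : 0 < volume.real (Metric.ball (0 : EuclideanSpace ℝ (Fin n)) 1) := ENNReal.toReal_pos
    (Metric.measure_ball_pos volume 0 one_pos).ne' measure_ball_lt_top.ne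
  -- With `r = R / 8` this makes `σ * R ^ n` exactly half the volume of `B_r`.
  set σ := volume.real (Metric.ball (0 : EuclideanSpace ℝ (Fin n)) 1) / (2 * 8 ^ n) with hσ
  have hσ0 : 0 < σ := by positivity
  have key : ∀ R : ℝ, ∃ h : ℝ, 1 ≤ R → 0 < h ∧
      ∀ (F : EuclideanSpace ℝ (Fin n) → ℝ → EuclideanSpace ℝ (Fin n) → ℝ)
        (W : ℝ → EuclideanSpace ℝ (Fin n) → ℝ),
        DirichletGrowth p lam F → PotentialGrowth m lam W →
        ∀ Ω : Set (EuclideanSpace ℝ (Fin n)), IsOpen Ω → Metric.ball 0 R ⊆ Ω →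
        ∀ u : EuclideanSpace ℝ (Fin n) → ℝ, IsGLMinimizer p F W Ω u →
          1 - h ≤ essValue u 0 →
          ENNReal.ofReal (σ * R ^ n) ≤ volume (Metric.ball 0 R ∩ {x | 0 ≤ u x}) := by
    intro R
    by_cases hR : 1 ≤ R
    swap
    -- For `R < 1` nothing is claimed and `0` is a default value.
    · exact ⟨0, fun h => absurd h hR⟩
    set r := R / 8 with hr
    have hr0 : 0 < r := by positivity
    obtain ⟨ν, hν0, hν⟩ := exists_forall_le_of_measure_lt_le (n := n) hn0 hp.le hlam hm.le
      (by positivity : 0 < r / 2) (by linarith : r / 2 < r) (by linarith : r < 4 * r)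
    obtain ⟨k, hk0, hk1, hk⟩ := exists_measure_sublevel_le (n := n) hp hlam hm.le hr0
      (by positivity : 0 < σ * R ^ n) hν0
    -- Failure of the density bound will give `essValue u 0 ≤ 1 - k / 2`, which is strictly below `1
    -- - k / 4`.
    refine ⟨k / 4, fun _ => ⟨by positivity, ?_⟩⟩
    intro F W hF hW Ω hΩ hRΩ u hu hval
    obtain ⟨u₀, g₀, hu₀, huu₀⟩ := hu.exists_measurable hp.le hΩ
    by_contra! hsmall
    have h4Ω : Metric.closedBall 0 (4 * r) ⊆ Ω :=
      (Metric.closedBall_subset_ball (by linarith)).trans hRΩ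
    have hrR : Metric.ball (0 : EuclideanSpace ℝ (Fin n)) r ⊆ Metric.ball 0 R :=
      Metric.ball_subset_ball (by linarith)
    have hpos : volume (Metric.ball 0 r ∩ {x | 0 ≤ u₀ x}) ≤ ENNReal.ofReal (σ * R ^ n) := by
      refine le_trans ?_ hsmall.le
      refine measure_mono_ae ?_
      have hae : ∀ᵐ x ∂(volume.restrict Ω), u x = u₀ x := huu₀
      rw [ae_restrict_iff' hΩ.measurableSet] at hae
      filter_upwards [hae] with x hx hxm
      exact ⟨hrR hxm.1, by
        have h1 : 0 ≤ u₀ x := hxm.2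
        rw [← hx (hRΩ (hrR hxm.1))] at h1
        exact h1⟩
    have hvol : volume (Metric.ball (0 : EuclideanSpace ℝ (Fin n)) r)
        = ENNReal.ofReal (σ * R ^ n) + ENNReal.ofReal (σ * R ^ n) := by
      rw [Measure.addHaar_ball_of_pos _ _ hr0, finrank_euclideanSpace_fin,
        ← ENNReal.ofReal_add (by positivity) (by positivity),
        ← ofReal_measureReal (measure_ball_lt_top.ne), ← ENNReal.ofReal_mul (by positivity)]
      congr 1
      rw [hσ, hr, div_pow]
      field_simp
      ring
    -- The set `{u₀ ≥ 0}` fills at most half of `B_r`, so `{u₀ ≤ 0}` fills at least the other half.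
    have hα : ENNReal.ofReal (σ * R ^ n) ≤ volume (Metric.ball 0 r ∩ {x | 1 ≤ 1 - u₀ x}) := by
      have h1 : volume (Metric.ball (0 : EuclideanSpace ℝ (Fin n)) r)
          ≤ volume (Metric.ball 0 r ∩ {x | 0 ≤ u₀ x})
            + volume (Metric.ball 0 r ∩ {x | 1 ≤ 1 - u₀ x}) := by
        refine (measure_mono ?_).trans (measure_union_le _ _)
        intro x hx
        rcases le_total 0 (u₀ x) with h | h
        · exact Or.inl ⟨hx, h⟩
        · exact Or.inr ⟨hx, by simpa using h⟩
      rw [hvol] at h1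
      exact (ENNReal.add_le_add_iff_left ENNReal.ofReal_ne_top).1
        (h1.trans (add_le_add hpos le_rfl))
    have hzero := hν F W Ω u₀ g₀ hu₀ hF hW hΩ h4Ω k hk0 hk1
      (hk F W Ω u₀ g₀ hu₀ hF hW hΩ h4Ω hα)
    have hess : essValue u 0 ≤ 1 - k / 2 := by
      refine essValue_le_of_ae_ball (s := r / 2) (a := -1) (by positivity) ?_
      have hsub : Metric.ball 0 (r / 2) ⊆ Ω :=
        (Metric.ball_subset_ball (by linarith)).trans hRΩ
      have h1 : ∀ᵐ x ∂(volume.restrict (Metric.ball 0 (r / 2))), ¬ (1 - u₀ x < k / 2) := by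
        rw [ae_restrict_iff' measurableSet_ball]
        filter_upwards [measure_eq_zero_iff_ae_notMem.1 hzero] with x hx hxb hlt
        exact hx ⟨hxb, hlt⟩
      filter_upwards [h1, ae_restrict_of_ae_restrict_of_subset hsub huu₀] with x hx hxu
      rw [hxu]
      exact ⟨(hu₀.mem_Icc x).1, by linarith [not_lt.1 hx]⟩
    linarith
  choose h hh using key
  exact ⟨σ, hσ0, h, fun R hR => (hh R hR).1, fun F W hF hW _ R hR Ω hΩ hRΩ u hu hval =>
    (hh R hR).2 F W hF hW Ω hΩ hRΩ u hu hval⟩
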